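/- Let $(\Omega,\mathcal F,\mathbb F=(\mathcal F_t)_{t\ge0},\mathsf P)$ be a complete filtered probability space satisfying the usual conditions and carrying an $\mathbb F$-Brownian motion $W$. Let $\theta,b,\eta,\rho,K>0$ and $\mu\in\mathbb R$. Let $\mathcal A$ be the set of $\mathbb F$-adapted real processes $\xi=(\xi_t)_{t\ge 0}$ whose paths are a.s. càdlàg and locally of finite variation; write $\xi=\xi^+-\xi^-$ for the minimal decomposition into nondecreasing processes (with $\xi^\pm_{0^-}=0$) and $|\xi|_t=\xi^+_t+\xi^-_t$. For $(x,r)\in\mathbb R^2$ and $\xi\in\mathcal A$ set $R_t=r+\xi^+_t-\xi^-_t$, and let $X$ be the unique strong solution of $$dX_t=\theta(\mu-bR_t-X_t)\,dt+\eta\,dW_t,\qquad X_0=x .$$ For $f:\mathbb R^2\to[0,\infty)$ define $$V(x,r)=\inf_{\xi\in\mathcal A}\mathsf E\Big[\int_0^\infty e^{-\rho t}f(X_t,R_t)\,dt+\int_{[0,\infty)}e^{-\rho t}K\,d|\xi|_t\Big].$$ Assume that there are $p>1$ and $C_0,C_1,C_2>0$ such that, for all $z,z'\in\mathbb R^2$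 and $\lambda\in(0,1)$, with $|\cdot|$ the Euclidean norm, * $0\le f(z)\le C_0(1+|z|)^p$; * $|f(z)-f(z')|\le C_1(1+f(z)+f(z'))^{1-1/p}|z-z'|$; * $0\le\lambda f(z)+(1-\lambda)f(z')-f(\lambda z+(1-\lambda)z')\le C_2\lambda(1-\lambda)(1+f(z)+f(z'))^{(1-2/p)^+}|z-z'|^2$; * $x\mapsto f_r(x,r)$ is nonincreasing for every $r\in\mathbb R$. Then $V$ is finite on $\mathbb R^2$, and there exist constants $\hat C_0,\hat C_1,\hat C_2>0$ such that, for all $z=(x,r),z'\in\mathbb R^2$ and $\lambda\in(0,1)$: 1. $0\le V(z)\le\hat C_0(1+|z|^p)+\big(-K\min\{r,0\}\wedge K\max\{r,0\}\big)$; 2. $|V(z)-V(z')|\le\hat C_1(1+|z|+|z'|)^{p-1}|z-z'|$; 3. $0\le\lambda V(z)+(1-\lambda)V(z')-V(\lambda z+(1-\lambda)z')\le\hat C_2\lambda(1-\lambda)(1+|z|+|z'|)^{(p-2)^+}|z-z'|^2$. In particular $V$ is convex and locally semiconcave (that is, on every compact set it satisfies an upper bound $C\lambda(1-\lambda)|z-z'|^2$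 for the middle expression in 3, for all segments contained in the set), and $V$ belongs to $W^{2,\infty}_{loc}(\mathbb R^2)$ and to $C^{1,\mathrm{Lip}}_{loc}(\mathbb R^2)$ (continuously differentiable with locally Lipschitz derivative). -/

import Mathlib

open MeasureTheory ProbabilityTheory Set Filter Topology
open scoped NNReal ENNReal

namespace MeanRevControl

noncomputable section

/-- The Euclidean plane; a point is `z = (x, r)` with `x = z 0` and `r = z 1`. -/
abbrev Plane : Type := EuclideanSpace ℝ (Fin 2)

/-! ### Probabilistic setting -/

/-- The filtration `𝓕` satisfies the usual conditions: it is right-continuous and `𝓕 0` contains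
all `P`-null sets. (In particular `P` is complete.) -/
structure UsualConditions {Ω : Type*} [mΩ : MeasurableSpace Ω] (P : Measure Ω)
    (𝓕 : Filtration ℝ≥0 mΩ) : Prop where
  rightContinuous : 𝓕.IsRightContinuous
  complete : ∀ s : Set Ω, P s = 0 → MeasurableSet[𝓕 0] s

/-- `W` is a real Brownian motion relative to the filtration `𝓕`: a Brownian motion which is
`𝓕`-adapted and whose increments after time `s` are independent of `𝓕 s`. -/
structure IsFiltrationBrownian {Ω : Type*} [mΩ : MeasurableSpace Ω] (P : Measure Ω)
    (𝓕 : Filtration ℝ≥0 mΩ) (W : ℝ≥0 → Ω → ℝ) : Prop where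
  brownian : IsBrownianReal W P
  adapted : Adapted 𝓕 W
  indep : ∀ s t : ℝ≥0, s ≤ t →
    Indep (MeasurableSpace.comap (fun ω => W t ω - W s ω) inferInstance) (𝓕 s) P

/-! ### Paths of locally finite variation on `[0, ∞)` -/

/-- Right-continuous with left limits. -/
def IsCadlag (g : ℝ≥0 → ℝ) : Prop :=
  ∀ t : ℝ≥0, ContinuousWithinAt g (Ici t) t ∧ ∃ l : ℝ, Tendsto g (𝓝[<] t) (𝓝 l)

/-- The total variation `|g|_t` of a path with the convention `g_{0-} = 0`: the variation over
`[0, t]` plus the size `|g 0|` of the jump at time `0`. It vanishes for `t < 0`. -/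
def totalVar (g : ℝ≥0 → ℝ) (t : ℝ) : ℝ :=
  if t < 0 then 0 else |g 0| + (eVariationOn g (Icc 0 t.toNNReal)).toReal

/-- The increasing part `g⁺` of the minimal (Jordan) decomposition `g = g⁺ - g⁻`. -/
def posVar (g : ℝ≥0 → ℝ) (t : ℝ≥0) : ℝ := (totalVar g t + g t) / 2

/-- The decreasing part `g⁻` of the minimal (Jordan) decomposition `g = g⁺ - g⁻`. -/
def negVar (g : ℝ≥0 → ℝ) (t : ℝ≥0) : ℝ := (totalVar g t - g t) / 2

theorem posVar_sub_negVar (g : ℝ≥0 → ℝ) (t : ℝ≥0) : posVar g t - negVar g t = g t := by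
  unfold posVar negVar; ring

theorem posVar_add_negVar (g : ℝ≥0 → ℝ) (t : ℝ≥0) : posVar g t + negVar g t = totalVar g t := by
  unfold posVar negVar; ring

theorem monotone_totalVar {g : ℝ≥0 → ℝ} (hg : LocallyBoundedVariationOn g univ) :
    Monotone (totalVar g) := by
  intro s t hst
  unfold totalVar
  by_cases ht : t < 0
  · simp [ht, lt_of_le_of_lt hst ht]
  by_cases hs : s < 0
  · simp only [hs, ht, if_true, if_false]; positivity
  simp only [hs, ht, if_false]
  have hfin : eVariationOn g (Icc 0 t.toNNReal) ≠ ⊤ := by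
    have h := hg 0 t.toNNReal (mem_univ _) (mem_univ _)
    rwa [univ_inter] at h
  have := ENNReal.toReal_mono hfin
    (eVariationOn.mono g (Icc_subset_Icc_right (Real.toNNReal_le_toNNReal hst)))
  linarith

open Classical in
/-- The Lebesgue–Stieltjes measure `d|g|` of the total variation of a path `g` of locally finite
variation, including the mass `|g 0|` at time `0`. (`Monotone.stieltjesFunction` is the
right-continuous version of a monotone function; for a right-continuous path `g` it is `|g|`
itself.) -/
def totalVarMeasure (g : ℝ≥0 → ℝ) : Measure ℝ :=
  if hg : LocallyBoundedVariationOn g univ then (monotone_totalVar hg).stieltjesFunction.measure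
  else 0

/-! ### The control problem -/

/-- The constants of the model. -/
structure Model where
  θ : ℝ
  μ : ℝ
  b : ℝ
  η : ℝ
  ρ : ℝ
  K : ℝ
  θ_pos : 0 < θ
  b_pos : 0 < b
  η_pos : 0 < η
  ρ_pos : 0 < ρ
  K_pos : 0 < K

/-- The purely controlled component `R_t = r + ξ⁺_t - ξ⁻_t`. -/
def controlledLevel {Ω : Type*} (r : ℝ) (ξ : ℝ≥0 → Ω → ℝ) (t : ℝ≥0) (ω : Ω) : ℝ :=
  r + posVar (fun s => ξ s ω) t - negVar (fun s => ξ s ω) t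

theorem controlledLevel_eq {Ω : Type*} (r : ℝ) (ξ : ℝ≥0 → Ω → ℝ) (t : ℝ≥0) (ω : Ω) :
    controlledLevel r ξ t ω = r + ξ t ω := by
  unfold controlledLevel
  rw [add_sub_assoc, posVar_sub_negVar]

section Control

variable {Ω : Type*} [mΩ : MeasurableSpace Ω]

/-- The set of admissible controls: adapted processes whose paths are a.s. càdlàg and locally of
finite variation. -/
def admissible (P : Measure Ω) (𝓕 : Filtration ℝ≥0 mΩ) : Set (ℝ≥0 → Ω → ℝ) :=
  {ξ | Adapted 𝓕 ξ ∧ ∀ᵐ ω ∂P, IsCadlag (fun t => ξ t ω) ∧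
    LocallyBoundedVariationOn (fun t => ξ t ω) univ}

/-- `X` is a strong solution of `dX_t = θ (μ - b R_t - X_t) dt + η dW_t`, `X_0 = x`, where
`R_t = r + ξ⁺_t - ξ⁻_t`: it is adapted, its paths are a.s. continuous, and a.s. the integrated
equation holds at all times. -/
def IsStateSolution (M : Model) (P : Measure Ω) (𝓕 : Filtration ℝ≥0 mΩ) (W : ℝ≥0 → Ω → ℝ)
    (x r : ℝ) (ξ X : ℝ≥0 → Ω → ℝ) : Prop :=
  Adapted 𝓕 X ∧ ∀ᵐ ω ∂P, Continuous (fun t => X t ω) ∧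
    ∀ t : ℝ≥0, X t ω = x
      + (∫ s in (0 : ℝ)..t,
          M.θ * (M.μ - M.b * controlledLevel r ξ s.toNNReal ω - X s.toNNReal ω))
      + M.η * (W t ω - W 0 ω)

/-- The expected discounted cost `E[∫₀^∞ e^{-ρt} f(X_t, R_t) dt + ∫_{[0,∞)} e^{-ρt} K d|ξ|_t]`
of the control `ξ` with state process `X`, as an extended nonnegative number. -/
def cost (M : Model) (P : Measure Ω) (f : Plane → ℝ) (r : ℝ) (ξ X : ℝ≥0 → Ω → ℝ) : ℝ≥0∞ :=
  ∫⁻ ω, ((∫⁻ t in Ici (0 : ℝ), ENNReal.ofReal (Real.exp (-M.ρ * t) *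
              f !₂[X t.toNNReal ω, controlledLevel r ξ t.toNNReal ω]))
      + ∫⁻ t in Ici (0 : ℝ), ENNReal.ofReal (Real.exp (-M.ρ * t) * M.K)
              ∂(totalVarMeasure (fun s => ξ s ω))) ∂P

/-- The value function: the infimum of the cost over all admissible controls `ξ`, where the state
`X` is the solution of the controlled equation with initial data `(x, r)` (unique up to
indistinguishability). -/
def valueFn (M : Model) (P : Measure Ω) (𝓕 : Filtration ℝ≥0 mΩ) (W : ℝ≥0 → Ω → ℝ)
    (f : Plane → ℝ) (z : Plane) : ℝ≥0∞ :=
  ⨅ ξ ∈ admissible P 𝓕, ⨅ X, ⨅ _ : IsStateSolution M P 𝓕 W (z 0) (z 1) ξ X,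
    cost M P f (z 1) ξ X

end Control

/-- The standing assumption on the running cost `f`, with exponent `p` and constants `C₀, C₁, C₂`. -/
structure RunningCostAssumption (f : Plane → ℝ) (p C₀ C₁ C₂ : ℝ) : Prop where
  growth : ∀ z, 0 ≤ f z ∧ f z ≤ C₀ * (1 + ‖z‖) ^ p
  lipschitz : ∀ z z', |f z - f z'| ≤ C₁ * (1 + f z + f z') ^ (1 - 1 / p) * ‖z - z'‖
  convex_semiconcave : ∀ z z', ∀ l ∈ Ioo (0 : ℝ) 1,
    0 ≤ l * f z + (1 - l) * f z' - f (l • z + (1 - l) • z') ∧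
    l * f z + (1 - l) * f z' - f (l • z + (1 - l) • z') ≤
      C₂ * l * (1 - l) * (1 + f z + f z') ^ (max (1 - 2 / p) 0) * ‖z - z'‖ ^ 2
  antitone_deriv : ∀ r : ℝ, Antitone fun x : ℝ => deriv (fun s : ℝ => f !₂[x, s]) r

/-! ### Function spaces on the plane -/

/-- Locally semiconcave (with linear modulus): semiconcave on every compact set. -/
def LocallySemiconcave (u : Plane → ℝ) : Prop :=
  ∀ S : Set Plane, IsCompact S → ∃ C : ℝ, 0 ≤ C ∧ ∀ z z' : Plane, segment ℝ z z' ⊆ S →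
    ∀ l ∈ Icc (0 : ℝ) 1,
      l * u z + (1 - l) * u z' - u (l • z + (1 - l) • z') ≤ C * l * (1 - l) * ‖z - z'‖ ^ 2

/-- Membership in `C^{1,Lip}_loc`. -/
def MemC1LipLoc (u : Plane → ℝ) : Prop :=
  ContDiff ℝ 1 u ∧ LocallyLipschitz (fderiv ℝ u)

/-- Membership in `L^∞_loc`. -/
def MemLinftyLoc (u : Plane → ℝ) : Prop :=
  ∀ S : Set Plane, IsCompact S → MemLp u ⊤ (volume.restrict S)

/-- `v` is the weak partial derivative of `u` in the `i`-th coordinate. -/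
def IsWeakPartial (i : Fin 2) (u v : Plane → ℝ) : Prop :=
  LocallyIntegrable u ∧ LocallyIntegrable v ∧
    ∀ φ : Plane → ℝ, ContDiff ℝ (⊤ : ℕ∞) φ → HasCompactSupport φ →
      ∫ z, u z * fderiv ℝ φ z (EuclideanSpace.single i 1) = - ∫ z, v z * φ z

/-- Membership in `W^{2,∞}_loc`: the function and its weak derivatives of first and second order
are in `L^∞_loc`. -/
def MemW2InftyLoc (u : Plane → ℝ) : Prop :=
  MemLinftyLoc u ∧ ∃ (g : Fin 2 → Plane → ℝ) (h : Fin 2 → Fin 2 → Plane → ℝ),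
    (∀ i, IsWeakPartial i u (g i) ∧ MemLinftyLoc (g i)) ∧
    ∀ i j, IsWeakPartial j (g i) (h i j) ∧ MemLinftyLoc (h i j)

end

end MeanRevControl

namespace MeanRevControl

noncomputable section

/-! ### Paths of locally finite variation -/

/-! Use one control `ξ` from two initial points. By linearity of the dynamics the controlled pairs
differ by a deterministic displacement, `pairShift`, of norm at most `2 + b` times the distance of
the initial points, and the variation cost is the same for both. Hence any inequality for `f` under
such displacements integrates to the costs and, after the infimum over `ξ`, passes to `V`
(`valueFn_pair_le`). No near-optimal control and no moment estimate for controlled states is needed.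

For this the hypotheses on `f` are recast as inequalities linear in `f`, of the form `f w' ≤ (1 + c
/ B) f w + c` with `B ≥ 1` (`exists_lipschitz`, and `exists_semiconcave` for two displaced points).
They become `V z' ≤ (1 + c / B) V z + c / ρ`. With `N = 1 + ‖z‖ + ‖z'‖` and `B = N ^ p`, the growth
bound makes `V / B` bounded, so the increment is of order `c`. Here `c` is a multiple of `N ^ (p -
1) ‖z - z'‖` in the Lipschitz case and of `l (1 - l) N ^ (p - 2)⁺ ‖z - z'‖²` in the semiconcave
case. Both forms rest on `exists_comparison`, which bounds `f` at a displaced point by `f` at the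
original one. It also yields the growth bound from the finiteness of `V 0`, which holds because the
uncontrolled Ornstein–Uhlenbeck state has moments of polynomial growth in time.

Convexity comes from combining controls: the state equation is affine, while `f` and the total
variation are convex (`cost_combo_le`). Finally, a convex function whose second differences are
locally quadratic has a unique subgradient at each point, depending on the point in a locally
Lipschitz way (`contDiff_one_and_locallyLipschitz_fderiv`). Its partial derivatives then have
locally bounded weak derivatives. -/

theorem lintegral_Ici_exp_neg {ρ : ℝ} (hρ : 0 < ρ) (t : ℝ) :
    ∫⁻ s in Ici t, ENNReal.ofReal (ρ * Real.exp (-ρ * s)) = ENNReal.ofReal (Real.exp (-ρ * t)) := by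
  rw [setLIntegral_congr Ioi_ae_eq_Ici.symm, ← ofReal_integral_eq_lintegral_ofReal]
  · rw [integral_const_mul, integral_exp_mul_Ioi (by linarith)]
    congr 1
    field_simp
  · exact (integrableOn_exp_mul_Ioi (by linarith) t).const_mul ρ
  · exact ae_of_all _ fun s => by positivity

/-- Tonelli, after writing `e^{-ρt}` as the integral of `ρ e^{-ρs}` over `s ≥ t`. The Stieltjes
measure is traded for a Lebesgue integral of `F`, so that pointwise inequalities between total
variations can be integrated. -/
theorem lintegral_exp_stieltjes {ρ : ℝ} (hρ : 0 < ρ) {F : ℝ → ℝ} (hF : Monotone F)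
    (h0 : ∀ t < 0, F t = 0) :
    ∫⁻ t in Ici (0 : ℝ), ENNReal.ofReal (Real.exp (-ρ * t)) ∂hF.stieltjesFunction.measure =
      ∫⁻ s in Ici (0 : ℝ), ENNReal.ofReal (ρ * Real.exp (-ρ * s)) * ENNReal.ofReal (F s) := by
  -- The left limit at `0` vanishes, so the measure of `[0, s]` includes the initial jump.
  have hleft : Function.leftLim hF.stieltjesFunction 0 = 0 := by
    have h1 : Tendsto hF.stieltjesFunction (𝓝[<] 0) (𝓝 0) := by
      refine tendsto_const_nhds.congr' ?_
      filter_upwards [self_mem_nhdsWithin] with t ht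
      rw [hF.stieltjesFunction_eq]
      refine ((rightLim_eq_of_tendsto ?_)).symm
      refine tendsto_const_nhds.congr' ?_
      filter_upwards [mem_nhdsWithin_of_mem_nhds (Iio_mem_nhds ht)] with s hs
      exact (h0 s hs).symm
    exact leftLim_eq_of_tendsto h1
  -- The right-continuous version can differ from `F` only at its countably many discontinuities.
  have hae : ∀ᵐ s, hF.stieltjesFunction s = F s := by
    have hc := hF.countable_not_continuousAt
    filter_upwards [hc.ae_notMem volume] with s hs
    have hs' : ContinuousAt F s := by simpa using hs
    rw [hF.stieltjesFunction_eq]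
    exact rightLim_eq_of_tendsto (hs'.mono_left nhdsWithin_le_nhds)
  have hmeas : Measurable (Function.uncurry fun t s : ℝ =>
      (Ici t).indicator (fun s => ENNReal.ofReal (ρ * Real.exp (-ρ * s))) s) := by
    have : (Function.uncurry fun t s : ℝ =>
      (Ici t).indicator (fun s => ENNReal.ofReal (ρ * Real.exp (-ρ * s))) s) =
      {q : ℝ × ℝ | q.1 ≤ q.2}.indicator (fun q => ENNReal.ofReal (ρ * Real.exp (-ρ * q.2))) := by
      ext ⟨t, s⟩
      simp [indicator]
    rw [this]
    exact Measurable.indicator (by fun_prop) (measurableSet_le measurable_fst measurable_snd)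
  calc _ = ∫⁻ t in Ici (0 : ℝ), (∫⁻ s,
        (Ici t).indicator (fun s => ENNReal.ofReal (ρ * Real.exp (-ρ * s))) s)
          ∂hF.stieltjesFunction.measure := by
        refine lintegral_congr fun t => ?_
        rw [lintegral_indicator measurableSet_Ici, lintegral_Ici_exp_neg hρ]
    _ = ∫⁻ s, (∫⁻ t in Ici (0 : ℝ), (Ici t).indicator
          (fun s => ENNReal.ofReal (ρ * Real.exp (-ρ * s))) s ∂hF.stieltjesFunction.measure) :=
        lintegral_lintegral_swap hmeas.aemeasurable
    _ = ∫⁻ s, (Ici (0 : ℝ)).indicator (fun s => ENNReal.ofReal (ρ * Real.exp (-ρ * s)) *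
          ENNReal.ofReal (F s)) s := by
        refine lintegral_congr_ae ?_
        filter_upwards [hae] with s hs
        have : ∀ t, (Ici t).indicator (fun s => ENNReal.ofReal (ρ * Real.exp (-ρ * s))) s =
            (Iic s).indicator (fun _ => ENNReal.ofReal (ρ * Real.exp (-ρ * s))) t := by
          intro t; simp [indicator]
        simp_rw [this]
        rw [lintegral_indicator measurableSet_Iic, lintegral_const, Measure.restrict_restrict
          measurableSet_Iic, Measure.restrict_apply MeasurableSet.univ, univ_inter, inter_comm,
          Ici_inter_Iic, StieltjesFunction.measure_Icc, hleft, hs, sub_zero]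
        by_cases h : 0 ≤ s
        · simp [h]
        · simp [h, h0 s (not_le.1 h)]
    _ = _ := lintegral_indicator measurableSet_Ici _

theorem totalVar_of_neg (g : ℝ≥0 → ℝ) {t : ℝ} (ht : t < 0) : totalVar g t = 0 := if_pos ht

theorem totalVar_of_nonneg (g : ℝ≥0 → ℝ) {t : ℝ} (ht : 0 ≤ t) :
    totalVar g t = |g 0| + (eVariationOn g (Icc 0 t.toNNReal)).toReal := if_neg (not_lt.2 ht)

theorem lintegral_totalVarMeasure {ρ K : ℝ} (hρ : 0 < ρ) {g : ℝ≥0 → ℝ}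
    (hg : LocallyBoundedVariationOn g univ) :
    ∫⁻ t in Ici (0 : ℝ), ENNReal.ofReal (Real.exp (-ρ * t) * K) ∂(totalVarMeasure g) =
      ∫⁻ t in Ici (0 : ℝ), ENNReal.ofReal (ρ * Real.exp (-ρ * t) * K) *
        ENNReal.ofReal (totalVar g t) := by
  have hK' : ∀ t, ENNReal.ofReal (Real.exp (-ρ * t) * K) =
      ENNReal.ofReal (Real.exp (-ρ * t)) * ENNReal.ofReal K := fun t =>
    ENNReal.ofReal_mul (Real.exp_nonneg _)
  have hK2 : ∀ t, ENNReal.ofReal (ρ * Real.exp (-ρ * t) * K) * ENNReal.ofReal (totalVar g t) =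
      ENNReal.ofReal (ρ * Real.exp (-ρ * t)) * ENNReal.ofReal (totalVar g t) *
        ENNReal.ofReal K := fun t => by
    rw [ENNReal.ofReal_mul (by positivity)]; ring
  simp_rw [hK', hK2]
  rw [lintegral_mul_const' _ _ ENNReal.ofReal_ne_top, lintegral_mul_const' _ _ ENNReal.ofReal_ne_top,
    totalVarMeasure, dif_pos hg, lintegral_exp_stieltjes hρ _ fun t ht => totalVar_of_neg g ht]

/-- The triangle inequality in each partition sum. The extended-valued form gives both the
finiteness of the combined variation and its bound. -/
theorem eVariationOn_combo_le {α : Type*} [LinearOrder α] (g h : α → ℝ) (s : Set α) {l : ℝ}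
    (hl : l ∈ Icc (0 : ℝ) 1) :
    eVariationOn (fun t => l * g t + (1 - l) * h t) s ≤
      ENNReal.ofReal l * eVariationOn g s + ENNReal.ofReal (1 - l) * eVariationOn h s := by
  refine iSup_le fun q => ?_
  have hq : ∀ i, edist (l * g (q.2.1 (i + 1)) + (1 - l) * h (q.2.1 (i + 1)))
      (l * g (q.2.1 i) + (1 - l) * h (q.2.1 i)) ≤
      ENNReal.ofReal l * edist (g (q.2.1 (i + 1))) (g (q.2.1 i)) +
        ENNReal.ofReal (1 - l) * edist (h (q.2.1 (i + 1))) (h (q.2.1 i)) := by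
    intro i
    rw [edist_dist, edist_dist, edist_dist, ← ENNReal.ofReal_mul hl.1,
      ← ENNReal.ofReal_mul (by linarith [hl.2]), ← ENNReal.ofReal_add
        (mul_nonneg hl.1 dist_nonneg) (mul_nonneg (by linarith [hl.2]) dist_nonneg)]
    refine ENNReal.ofReal_le_ofReal ?_
    rw [Real.dist_eq, Real.dist_eq, Real.dist_eq]
    calc _ = |l * (g (q.2.1 (i + 1)) - g (q.2.1 i)) +
          (1 - l) * (h (q.2.1 (i + 1)) - h (q.2.1 i))| := by ring_nf
      _ ≤ _ := by
        refine (abs_add_le _ _).trans (le_of_eq ?_)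
        rw [abs_mul, abs_mul, abs_of_nonneg hl.1, abs_of_nonneg (by linarith [hl.2] : 0 ≤ 1 - l)]
  calc _ ≤ ∑ i ∈ Finset.range q.1, _ := Finset.sum_le_sum fun i _ => hq i
    _ = _ := by rw [Finset.sum_add_distrib, ← Finset.mul_sum, ← Finset.mul_sum]
    _ ≤ _ := add_le_add (mul_le_mul_right (eVariationOn.sum_le q.2.2.1 q.2.2.2) _)
        (mul_le_mul_right (eVariationOn.sum_le q.2.2.1 q.2.2.2) _)

theorem locallyBoundedVariationOn_combo {g h : ℝ≥0 → ℝ} (hg : LocallyBoundedVariationOn g univ)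
    (hh : LocallyBoundedVariationOn h univ) {l : ℝ} (hl : l ∈ Icc (0 : ℝ) 1) :
    LocallyBoundedVariationOn (fun t => l * g t + (1 - l) * h t) univ := by
  intro a b ha hb
  refine ne_top_of_le_ne_top ?_ (eVariationOn_combo_le g h _ hl)
  exact ENNReal.add_ne_top.2 ⟨ENNReal.mul_ne_top ENNReal.ofReal_ne_top (hg a b ha hb),
    ENNReal.mul_ne_top ENNReal.ofReal_ne_top (hh a b ha hb)⟩

theorem totalVar_nonneg (g : ℝ≥0 → ℝ) (t : ℝ) : 0 ≤ totalVar g t := by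
  unfold totalVar
  split_ifs
  · exact le_rfl
  · positivity

theorem totalVar_combo_le {g h : ℝ≥0 → ℝ} (hg : LocallyBoundedVariationOn g univ)
    (hh : LocallyBoundedVariationOn h univ) {l : ℝ} (hl : l ∈ Icc (0 : ℝ) 1) (t : ℝ) :
    totalVar (fun t => l * g t + (1 - l) * h t) t ≤ l * totalVar g t + (1 - l) * totalVar h t := by
  rcases lt_or_ge t 0 with ht | ht
  · simp [totalVar_of_neg _ ht]
  have hl' : 0 ≤ 1 - l := by linarith [hl.2]
  have fin : ∀ {g : ℝ≥0 → ℝ}, LocallyBoundedVariationOn g univ →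
      eVariationOn g (Icc 0 t.toNNReal) ≠ ⊤ := by
    intro g hg
    have h := hg 0 t.toNNReal (mem_univ _) (mem_univ _)
    rwa [univ_inter] at h
  rw [totalVar_of_nonneg _ ht, totalVar_of_nonneg _ ht, totalVar_of_nonneg _ ht]
  have h1 : |l * g 0 + (1 - l) * h 0| ≤ l * |g 0| + (1 - l) * |h 0| := by
    refine (abs_add_le _ _).trans (le_of_eq ?_)
    rw [abs_mul, abs_mul, abs_of_nonneg hl.1, abs_of_nonneg hl']
  have h2 := ENNReal.toReal_mono (ENNReal.add_ne_top.2
    ⟨ENNReal.mul_ne_top ENNReal.ofReal_ne_top (fin hg),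
      ENNReal.mul_ne_top ENNReal.ofReal_ne_top (fin hh)⟩)
    (eVariationOn_combo_le g h (Icc 0 t.toNNReal) hl)
  rw [ENNReal.toReal_add (ENNReal.mul_ne_top ENNReal.ofReal_ne_top (fin hg))
    (ENNReal.mul_ne_top ENNReal.ofReal_ne_top (fin hh)), ENNReal.toReal_mul, ENNReal.toReal_mul,
    ENNReal.toReal_ofReal hl.1, ENNReal.toReal_ofReal hl'] at h2
  linarith

/-! ### Measurability of right-continuous processes and of their total variation -/

/-- The `+ 1` after the floor puts the grid points to the right of `t`, so right-continuity alone
controls the values there. -/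
theorem tendsto_grid_right (t : ℝ≥0) :
    Tendsto (fun n : ℕ => ((⌊t * (n + 1)⌋₊ + 1 : ℕ) : ℝ≥0) / (n + 1)) atTop (𝓝[≥] t) := by
  refine tendsto_nhdsWithin_iff.2 ⟨?_, Eventually.of_forall fun n => ?_⟩
  · have hlim : Tendsto (fun n : ℕ => t + 1 / ((n : ℝ≥0) + 1)) atTop (𝓝 (t + 0)) :=
      tendsto_const_nhds.add tendsto_one_div_add_atTop_nhds_zero_nat
    rw [add_zero] at hlim
    refine tendsto_of_tendsto_of_tendsto_of_le_of_le tendsto_const_nhds hlim (fun n => ?_)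
      fun n => ?_
    · rw [le_div_iff₀ (by positivity)]
      push_cast
      exact (Nat.lt_floor_add_one _).le
    · show _ ≤ t + 1 / ((n : ℝ≥0) + 1)
      rw [div_le_iff₀ (by positivity), add_mul, one_div_mul_cancel (by positivity)]
      push_cast
      gcongr
      exact Nat.floor_le (by positivity)
  · show t ≤ _
    rw [le_div_iff₀ (by positivity)]
    push_cast
    exact (Nat.lt_floor_add_one _).le

/-- The process is the pointwise limit of processes constant on grid cells, with the value at the
right endpoint. Each of these involves only countably many times. -/
theorem measurable_uncurry_of_rightContinuous {Ω : Type*} [MeasurableSpace Ω] {G : ℝ≥0 → Ω → ℝ}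
    (hG : ∀ t, Measurable (G t))
    (hc : ∀ ω t, ContinuousWithinAt (fun s => G s ω) (Ici t) t) :
    Measurable (Function.uncurry G) := by
  refine measurable_of_tendsto_metrizable (f := fun (n : ℕ) (q : ℝ≥0 × Ω) =>
    G (((⌊q.1 * (n + 1)⌋₊ + 1 : ℕ) : ℝ≥0) / (n + 1)) q.2) (fun n => ?_) ?_
  · have : Measurable (Function.uncurry fun (k : ℕ) (ω : Ω) => G ((k : ℝ≥0) / (n + 1)) ω) :=
      measurable_from_prod_countable_right fun k => hG ((k : ℝ≥0) / (n + 1))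
    exact this.comp (f := fun q : ℝ≥0 × Ω => (⌊q.1 * (n + 1)⌋₊ + 1, q.2)) (by fun_prop)
  · rw [tendsto_pi_nhds]
    rintro ⟨t, ω⟩
    exact (hc ω t).tendsto.comp (tendsto_grid_right t)

/-- Paths are regular only almost surely, and the exceptional set need not be measurable. The
process is set to zero on a measurable null set containing it. -/
theorem exists_measurable_modification {Ω : Type*} [MeasurableSpace Ω] {P : Measure Ω}
    {G : ℝ≥0 → Ω → ℝ} (hG : ∀ t, Measurable (G t))
    (hc : ∀ᵐ ω ∂P, ∀ t, ContinuousWithinAt (fun s => G s ω) (Ici t) t) :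
    ∃ G' : ℝ≥0 → Ω → ℝ, Measurable (Function.uncurry G') ∧ (∀ᵐ ω ∂P, ∀ t, G' t ω = G t ω) ∧
      ∀ ω t, ContinuousWithinAt (fun s => G' s ω) (Ici t) t := by
  obtain ⟨S, hS, hSm, hS0⟩ : ∃ S : Set Ω,
      (∀ ω ∈ S, ∀ t, ContinuousWithinAt (fun s => G s ω) (Ici t) t) ∧
        MeasurableSet S ∧ P Sᶜ = 0 := by
    refine ⟨(toMeasurable P {ω | ¬ ∀ t, ContinuousWithinAt (fun s => G s ω) (Ici t) t})ᶜ,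
      fun ω hω => ?_, (measurableSet_toMeasurable P _).compl, ?_⟩
    · by_contra h
      exact hω (subset_toMeasurable P _ h)
    · rw [compl_compl, measure_toMeasurable]
      exact hc
  have hcont : ∀ ω t, ContinuousWithinAt (fun s => S.indicator (G s) ω) (Ici t) t := by
    intro ω t
    by_cases h : ω ∈ S
    · simpa [h] using hS ω h t
    · simpa [h] using continuousWithinAt_const
  refine ⟨fun t => S.indicator (G t),
    measurable_uncurry_of_rightContinuous (fun t => (hG t).indicator hSm) hcont, ?_, hcont⟩
  have : ∀ᵐ ω ∂P, ω ∈ S := hS0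
  filter_upwards [this] with ω hω t
  simp [hω]

theorem sum_edist_comp_le (H : ℕ → ℝ) {a : ℕ → ℕ} (ha : Monotone a) (m : ℕ) :
    ∑ i ∈ Finset.range m, edist (H (a (i + 1))) (H (a i)) ≤
      ∑ k ∈ Finset.range (a m), edist (H (k + 1)) (H k) := by
  induction m with
  | zero => simp
  | succ m ih =>
    rw [Finset.sum_range_succ, ← Finset.sum_range_add_sum_Ico _ (ha m.le_succ)]
    refine add_le_add ih ?_
    rw [edist_comm]
    simpa only [edist_comm] using edist_le_Ico_sum_edist H (ha m.le_succ)

/-- Partition points are approximated from the right by grid points, and passing to a finer grid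
only increases the sum. The supremum becomes countable, which makes the total variation measurable
in the scenario. -/
theorem eVariationOn_eq_iSup_grid {g : ℝ≥0 → ℝ} (hg : ∀ t, ContinuousWithinAt g (Ici t) t)
    (t : ℝ≥0) : eVariationOn g (Icc 0 t) =
      ⨆ n : ℕ, ∑' k : ℕ, edist (g (min (((k + 1 : ℕ) : ℝ≥0) / (n + 1)) t))
        (g (min ((k : ℝ≥0) / (n + 1)) t)) := by
  refine le_antisymm (iSup_le fun ⟨m, u, hu, hut⟩ => ?_) (iSup_le fun n => ?_)
  · have htend : ∀ i, Tendsto (fun n : ℕ => g (min (((⌊u i * (n + 1)⌋₊ + 1 : ℕ) : ℝ≥0) / (n + 1)) t))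
        atTop (𝓝 (g (u i))) := by
      intro i
      refine (hg (u i)).tendsto.comp ?_
      have h := tendsto_nhdsWithin_iff.1 (tendsto_grid_right (u i))
      -- Truncation by `t` keeps the grid inside the interval and still to the right of `u i ≤ t`.
      refine tendsto_nhdsWithin_iff.2 ⟨?_, h.2.mono fun n hn => le_min hn (hut i).2⟩
      simpa [min_eq_left (hut i).2] using h.1.min (tendsto_const_nhds (x := t))
    refine le_of_tendsto (tendsto_finsetSum (Finset.range m) fun i _ =>
      (htend (i + 1)).edist (htend i)) (Eventually.of_forall fun n => ?_)
    refine le_trans ?_ (le_iSup _ n)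
    refine le_trans (sum_edist_comp_le (fun k : ℕ => g (min ((k : ℝ≥0) / (n + 1)) t))
      (a := fun i => ⌊u i * (n + 1)⌋₊ + 1) (fun i j hij => ?_) m) (ENNReal.sum_le_tsum _)
    have := hu hij
    show ⌊u i * (n + 1)⌋₊ + 1 ≤ ⌊u j * (n + 1)⌋₊ + 1
    gcongr
  · refine ENNReal.tsum_le_of_sum_range_le fun m => ?_
    refine eVariationOn.sum_le (u := fun k : ℕ => min ((k : ℝ≥0) / (n + 1)) t) (fun i j hij => ?_)
      fun i => ⟨zero_le, min_le_right _ _⟩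
    show min _ _ ≤ min _ _
    gcongr

theorem measurable_totalVar {Ω : Type*} [MeasurableSpace Ω] {G : ℝ≥0 → Ω → ℝ}
    (hG : Measurable (Function.uncurry G))
    (hc : ∀ ω t, ContinuousWithinAt (fun s => G s ω) (Ici t) t) :
    Measurable fun q : ℝ × Ω => totalVar (fun s => G s q.2) q.1 := by
  unfold totalVar
  refine Measurable.ite (measurableSet_lt measurable_fst measurable_const) measurable_const ?_
  have h0 : Measurable fun q : ℝ × Ω => G 0 q.2 :=
    hG.comp (f := fun q : ℝ × Ω => ((0 : ℝ≥0), q.2)) (by fun_prop)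
  refine h0.abs.add (Measurable.ennreal_toReal ?_)
  simp_rw [eVariationOn_eq_iSup_grid (hc _)]
  refine Measurable.iSup fun n => Measurable.tsum fun k => ?_
  refine Measurable.edist ?_ ?_
  · exact hG.comp (f := fun q : ℝ × Ω => (min (((k + 1 : ℕ) : ℝ≥0) / (n + 1)) q.1.toNNReal, q.2))
      (by fun_prop)
  · exact hG.comp (f := fun q : ℝ × Ω => (min ((k : ℝ≥0) / (n + 1)) q.1.toNNReal, q.2))
      (by fun_prop)

/-! ### Estimates for the running cost -/

theorem add_rpow_le_mul_add_rpow {x y p : ℝ} (hx : 0 ≤ x) (hy : 0 ≤ y) (hp : 1 ≤ p) :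
    (x + y) ^ p ≤ 2 ^ (p - 1) * (x ^ p + y ^ p) := by
  lift x to ℝ≥0 using hx
  lift y to ℝ≥0 using hy
  exact_mod_cast NNReal.rpow_add_le_mul_rpow_add_rpow x y hp

namespace RunningCostAssumption

variable {f : Plane → ℝ} {p C₀ C₁ C₂ : ℝ}

theorem nonneg (hf : RunningCostAssumption f p C₀ C₁ C₂) (z : Plane) : 0 ≤ f z := (hf.growth z).1

theorem convexOn (hf : RunningCostAssumption f p C₀ C₁ C₂) : ConvexOn ℝ univ f := by
  refine convexOn_iff_forall_pos.2 ⟨convex_univ, fun z _ z' _ a b ha hb hab => ?_⟩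
  obtain rfl : b = 1 - a := by linarith
  have := (hf.convex_semiconcave z z' a ⟨ha, by linarith⟩).1
  simp only [smul_eq_mul]
  linarith

theorem continuous (hf : RunningCostAssumption f p C₀ C₁ C₂) : Continuous f :=
  continuousOn_univ.1 (hf.convexOn.continuousOn isOpen_univ)

/-- The Lipschitz hypothesis says in effect that `(1 + f) ^ (1 / p)` is globally Lipschitz. Raising
this to the power `p` gives the comparison. -/
theorem exists_comparison (hf : RunningCostAssumption f p C₀ C₁ C₂) (hp : 1 < p) (hC₁ : 0 < C₁) :
    ∃ a : ℝ, 1 ≤ a ∧ ∀ w w', 1 + f w' ≤ a * (1 + f w + ‖w - w'‖ ^ p) := by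
  have hc : 0 ≤ (2 * C₁) ^ p := by positivity
  have h2 : (1 : ℝ) ≤ 2 ^ (p - 1) := Real.one_le_rpow (by norm_num) (by linarith)
  refine ⟨2 ^ (p - 1) * (1 + (2 * C₁) ^ p), by nlinarith, fun w w' => ?_⟩
  have hw := hf.nonneg w
  have hw' := hf.nonneg w'
  have hd : 0 ≤ ‖w - w'‖ ^ p := by positivity
  have hp0 : p ≠ 0 := by linarith
  rcases le_total (f w') (f w) with h | h
  · calc 1 + f w' ≤ 1 * (1 + f w + ‖w - w'‖ ^ p) := by linarith
      _ ≤ _ := by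
        gcongr
        nlinarith
  set u := (1 + f w') ^ (1 / p) with hu
  set v := (1 + f w) ^ (1 / p) with hv
  have hu0 : 0 < u := by positivity
  have hv0 : 0 < v := by positivity
  have hup : u ^ p = 1 + f w' := by
    rw [hu, ← Real.rpow_mul (by positivity), one_div_mul_cancel hp0, Real.rpow_one]
  have hvp : v ^ p = 1 + f w := by
    rw [hv, ← Real.rpow_mul (by positivity), one_div_mul_cancel hp0, Real.rpow_one]
  have hvu : v ≤ u := Real.rpow_le_rpow (by positivity) (by linarith) (by positivity)
  have hsplit : ∀ {x : ℝ}, 0 < x → x ^ p = x ^ (p - 1) * x := fun {x} hx => by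
    rw [← Real.rpow_add_one hx.ne']; congr 1; ring
  have hvpu : v ^ p ≤ u ^ (p - 1) * v := by
    rw [hsplit hv0]
    gcongr
  have hpow : (1 + f w + f w') ^ (1 - 1 / p) ≤ 2 * u ^ (p - 1) := by
    have hq0 : 0 ≤ 1 - 1 / p := by
      rw [sub_nonneg, div_le_one (by linarith)]; exact hp.le
    calc (1 + f w + f w') ^ (1 - 1 / p) ≤ (2 * u ^ p) ^ (1 - 1 / p) := by
          refine Real.rpow_le_rpow (by positivity) ?_ hq0
          rw [hup]; linarith
      _ = 2 ^ (1 - 1 / p) * u ^ (p - 1) := by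
          rw [Real.mul_rpow (by norm_num) (by positivity), ← Real.rpow_mul hu0.le]
          congr 2; field_simp
      _ ≤ 2 ^ (1 : ℝ) * u ^ (p - 1) := by
          gcongr
          · norm_num
          · linarith [show 0 < 1 / p by positivity]
      _ = _ := by rw [Real.rpow_one]
  -- Since `v ≤ u`, the left side is at most `u ^ p - v ^ p = f w' - f w`. The factor `u ^ (p - 1)`
  -- then cancels.
  have hkey : u ^ (p - 1) * (u - v) ≤ u ^ (p - 1) * (2 * C₁ * ‖w - w'‖) := by
    have h1 := hf.lipschitz w w'
    have h2 : f w' - f w ≤ |f w - f w'| := by rw [abs_sub_comm]; exact le_abs_self _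
    have h3 : C₁ * (1 + f w + f w') ^ (1 - 1 / p) * ‖w - w'‖ ≤
        C₁ * (2 * u ^ (p - 1)) * ‖w - w'‖ := by gcongr
    have h4 := hsplit hu0
    nlinarith
  have huv : u ≤ v + 2 * C₁ * ‖w - w'‖ := by
    have := le_of_mul_le_mul_left hkey (by positivity)
    linarith
  calc 1 + f w' = u ^ p := hup.symm
    _ ≤ (v + 2 * C₁ * ‖w - w'‖) ^ p := Real.rpow_le_rpow hu0.le huv (by linarith)
    _ ≤ 2 ^ (p - 1) * (v ^ p + (2 * C₁ * ‖w - w'‖) ^ p) :=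
        add_rpow_le_mul_add_rpow hv0.le (by positivity) hp.le
    _ = 2 ^ (p - 1) * ((1 + f w) + (2 * C₁) ^ p * ‖w - w'‖ ^ p) := by
        rw [hvp, Real.mul_rpow (by positivity) (by positivity)]
    _ ≤ 2 ^ (p - 1) * ((1 + (2 * C₁) ^ p) * (1 + f w + ‖w - w'‖ ^ p)) := by
        gcongr
        nlinarith [mul_nonneg hc (by linarith : 0 ≤ 1 + f w)]
    _ = _ := by ring

end RunningCostAssumption

/-- Factor out `B` and use `x ^ α ≤ x` for `x ≥ 1`. The bound is affine in `s`; with `s = f w` it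
can be integrated without Hölder's inequality. -/
theorem rpow_le_of_le_mul_add {A B y s α : ℝ} (hA : 1 ≤ A) (hB : 1 ≤ B) (hs : 0 ≤ s) (hy : 0 ≤ y)
    (h : y ≤ A * (B + s)) (hα : 0 ≤ α) (hα1 : α ≤ 1) : y ^ α ≤ A * B ^ α * (1 + s / B) := by
  have hB0 : 0 < B := by linarith
  have h1 : (1 : ℝ) ≤ 1 + s / B := by have : 0 ≤ s / B := by positivity
                                      linarith
  have key : ∀ {x : ℝ}, 1 ≤ x → x ^ α ≤ x := fun {x} hx => by
    simpa using Real.rpow_le_rpow_of_exponent_le hx hα1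
  calc y ^ α ≤ (A * (B * (1 + s / B))) ^ α := by
        refine Real.rpow_le_rpow hy (h.trans (le_of_eq ?_)) hα
        field_simp
    _ = A ^ α * (B ^ α * (1 + s / B) ^ α) := by
        rw [Real.mul_rpow (by positivity) (by positivity), Real.mul_rpow (by positivity) (by positivity)]
    _ ≤ A * (B ^ α * (1 + s / B)) := by
        gcongr
        · exact key hA
        · exact key h1
    _ = _ := by ring

namespace RunningCostAssumption

variable {f : Plane → ℝ} {p C₀ C₁ C₂ : ℝ}

/-- The parameter `B` is a scale, later `N ^ p`, at which the value function is known to be `O(B)`.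
The condition `d ^ p ≤ B` absorbs the distance term of `exists_comparison`. -/
theorem exists_lipschitz (hf : RunningCostAssumption f p C₀ C₁ C₂) (hp : 1 < p) (hC₁ : 0 < C₁)
    {κ : ℝ} (hκ : 0 < κ) :
    ∃ C : ℝ, 0 ≤ C ∧ ∀ B d : ℝ, 1 ≤ B → 0 ≤ d → d ^ p ≤ B → ∀ w w', ‖w - w'‖ ≤ κ * d →
      f w' ≤ (1 + C * B ^ (1 - 1 / p) * d / B) * f w + C * B ^ (1 - 1 / p) * d := by
  obtain ⟨a, ha, hfa⟩ := hf.exists_comparison hp hC₁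
  have hκp : 0 ≤ κ ^ p := by positivity
  refine ⟨C₁ * (a * (2 + κ ^ p)) * κ, by positivity, fun B d hB hd hdB w w' hww => ?_⟩
  have hw := hf.nonneg w
  have hw' := hf.nonneg w'
  have hB0 : 0 < B := by linarith
  have hq0 : 0 ≤ 1 - 1 / p := by
    rw [sub_nonneg, div_le_one (by linarith)]; exact hp.le
  have hq1 : 1 - 1 / p ≤ 1 := by linarith [show 0 < 1 / p by positivity]
  have hdp : ‖w - w'‖ ^ p ≤ κ ^ p * B := by
    calc ‖w - w'‖ ^ p ≤ (κ * d) ^ p := Real.rpow_le_rpow (norm_nonneg _) hww (by linarith)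
      _ = κ ^ p * d ^ p := Real.mul_rpow hκ.le hd
      _ ≤ _ := by gcongr
  have hbase : 1 + f w + f w' ≤ a * (2 + κ ^ p) * (B + f w) := by
    have h1 := hfa w w'
    have h2 : a * (1 + f w + ‖w - w'‖ ^ p) ≤ a * (B + f w + κ ^ p * B) := by gcongr
    have h3 : f w ≤ a * f w := le_mul_of_one_le_left hw ha
    nlinarith [mul_nonneg (mul_nonneg (by linarith : 0 ≤ a) hκp) hw,
      mul_nonneg (by linarith : 0 ≤ a) hB0.le]
  have hpow := rpow_le_of_le_mul_add (by nlinarith) hB hw (by positivity) hbase hq0 hq1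
  have h1 : f w' - f w ≤ |f w - f w'| := by rw [abs_sub_comm]; exact le_abs_self _
  have h2 : |f w - f w'| ≤
      C₁ * (a * (2 + κ ^ p) * B ^ (1 - 1 / p) * (1 + f w / B)) * (κ * d) :=
    (hf.lipschitz w w').trans (by gcongr)
  calc f w' ≤ f w + C₁ * (a * (2 + κ ^ p) * B ^ (1 - 1 / p) * (1 + f w / B)) * (κ * d) := by
        linarith
    _ = _ := by ring

/-- Both endpoints are compared with the intermediate point `m`, so that the right side involves
only `f m`, the cost to be integrated along the trajectory from the intermediate initial condition.
-/
theorem exists_semiconcave (hf : RunningCostAssumption f p C₀ C₁ C₂) (hp : 1 < p) (hC₁ : 0 < C₁)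
    (hC₂ : 0 < C₂) {κ : ℝ} (hκ : 0 < κ) :
    ∃ C : ℝ, 0 ≤ C ∧ ∀ B d l : ℝ, 1 ≤ B → 0 ≤ d → d ^ p ≤ B → l ∈ Ioo (0 : ℝ) 1 →
      ∀ w w', ‖w - w'‖ ≤ κ * d →
      l * f w + (1 - l) * f w' ≤
        (1 + C * l * (1 - l) * B ^ (max (1 - 2 / p) 0) * d ^ 2 / B) * f (l • w + (1 - l) • w') +
          C * l * (1 - l) * B ^ (max (1 - 2 / p) 0) * d ^ 2 := by
  obtain ⟨a, ha, hfa⟩ := hf.exists_comparison hp hC₁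
  have hκp : 0 ≤ κ ^ p := by positivity
  refine ⟨C₂ * (a * (2 + 2 * κ ^ p)) * κ ^ 2, by positivity,
    fun B d l hB hd hdB hl w w' hww => ?_⟩
  set m := l • w + (1 - l) • w' with hm
  have hl0 := hl.1
  have hl1 : 0 < 1 - l := by linarith [hl.2]
  have hw := hf.nonneg w
  have hw' := hf.nonneg w'
  have hfm := hf.nonneg m
  have hB0 : 0 < B := by linarith
  have hq0 : 0 ≤ max (1 - 2 / p) 0 := le_max_right _ _
  have hq1 : max (1 - 2 / p) 0 ≤ 1 := max_le (by linarith [show 0 < 2 / p by positivity]) (by norm_num)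
  have hdp : ∀ {x : ℝ}, 0 ≤ x → x ≤ ‖w - w'‖ → x ^ p ≤ κ ^ p * B := fun {x} hx hxw => by
    calc x ^ p ≤ (κ * d) ^ p := Real.rpow_le_rpow hx (hxw.trans hww) (by linarith)
      _ = κ ^ p * d ^ p := Real.mul_rpow hκ.le hd
      _ ≤ _ := by gcongr
  have hmw : ‖m - w‖ ^ p ≤ κ ^ p * B := by
    refine hdp (norm_nonneg _) ?_
    have : m - w = (1 - l) • (w' - w) := by rw [hm]; module
    rw [this, norm_smul, Real.norm_of_nonneg hl1.le, norm_sub_rev]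
    exact mul_le_of_le_one_left (norm_nonneg _) (by linarith)
  have hmw' : ‖m - w'‖ ^ p ≤ κ ^ p * B := by
    refine hdp (norm_nonneg _) ?_
    have : m - w' = l • (w - w') := by rw [hm]; module
    rw [this, norm_smul, Real.norm_of_nonneg hl0.le]
    exact mul_le_of_le_one_left (norm_nonneg _) hl.2.le
  have hbase : 1 + f w + f w' ≤ a * (2 + 2 * κ ^ p) * (B + f m) := by
    have h1 := hfa m w
    have h1' := hfa m w'
    have h2 : a * (1 + f m + ‖m - w‖ ^ p) ≤ a * (B + f m + κ ^ p * B) := by gcongr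
    have h2' : a * (1 + f m + ‖m - w'‖ ^ p) ≤ a * (B + f m + κ ^ p * B) := by gcongr
    nlinarith [mul_nonneg (mul_nonneg (by linarith : 0 ≤ a) hκp) hfm]
  have hpow := rpow_le_of_le_mul_add (by nlinarith) hB hfm (by positivity) hbase hq0 hq1
  have h2 := (hf.convex_semiconcave w w' l hl).2
  rw [← hm] at h2
  have h3 : C₂ * l * (1 - l) * (1 + f w + f w') ^ (max (1 - 2 / p) 0) * ‖w - w'‖ ^ 2 ≤
      C₂ * l * (1 - l) * (a * (2 + 2 * κ ^ p) * B ^ (max (1 - 2 / p) 0) * (1 + f m / B)) *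
        (κ * d) ^ 2 := by gcongr
  calc l * f w + (1 - l) * f w' ≤ f m +
        C₂ * l * (1 - l) * (a * (2 + 2 * κ ^ p) * B ^ (max (1 - 2 / p) 0) * (1 + f m / B)) *
        (κ * d) ^ 2 := by linarith
    _ = _ := by ring

end RunningCostAssumption

/-! ### Solutions of the state equation -/

theorem intervalIntegrable_toNNReal {g : ℝ≥0 → ℝ}
    (hg : LocallyBoundedVariationOn g univ) (a b : ℝ) :
    IntervalIntegrable (fun s : ℝ => g s.toNNReal) volume a b := by
  obtain ⟨u, v, hu, hv, rfl⟩ := hg.exists_monotoneOn_sub_monotoneOn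
  have h : ∀ {w : ℝ≥0 → ℝ}, MonotoneOn w univ → Monotone fun s : ℝ => w s.toNNReal :=
    fun hw s t hst => hw (mem_univ _) (mem_univ _) (Real.toNNReal_le_toNNReal hst)
  exact (h hu).intervalIntegrable.sub (h hv).intervalIntegrable

section State

variable {Ω : Type*} [mΩ : MeasurableSpace Ω] {P : Measure Ω} {𝓕 : Filtration ℝ≥0 mΩ}
  {W : ℝ≥0 → Ω → ℝ} {M : Model}

/-- The displacement of the state at time `t` caused by the displacement `h` of the initial
condition. -/
def stateShift (M : Model) (h : Plane) (t : ℝ) : ℝ :=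
  Real.exp (-M.θ * t) * h 0 - M.b * h 1 * (1 - Real.exp (-M.θ * t))

theorem continuous_stateShift (M : Model) (h : Plane) : Continuous (stateShift M h) := by
  unfold stateShift; fun_prop

theorem hasDerivAt_stateShift (M : Model) (h : Plane) (t : ℝ) :
    HasDerivAt (stateShift M h) (M.θ * (-(M.b * h 1) - stateShift M h t)) t := by
  have h1 : HasDerivAt (fun t => Real.exp (-M.θ * t)) (Real.exp (-M.θ * t) * (-M.θ)) t := by
    simpa using ((hasDerivAt_id t).const_mul (-M.θ)).exp
  refine ((h1.mul_const (h 0)).sub ((h1.const_sub 1).const_mul (M.b * h 1))).congr_deriv ?_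
  rw [stateShift]
  ring

theorem abs_stateShift_le (M : Model) (h : Plane) {t : ℝ} (ht : 0 ≤ t) :
    |stateShift M h t| ≤ (1 + M.b) * ‖h‖ := by
  have h0 : |h 0| ≤ ‖h‖ := by simpa using PiLp.norm_apply_le h 0
  have h1 : |h 1| ≤ ‖h‖ := by simpa using PiLp.norm_apply_le h 1
  have hb := M.b_pos
  have he0 : 0 < Real.exp (-M.θ * t) := Real.exp_pos _
  have he1 : Real.exp (-M.θ * t) ≤ 1 := by
    rw [Real.exp_le_one_iff]; nlinarith [M.θ_pos]
  unfold stateShift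
  calc |Real.exp (-M.θ * t) * h 0 - M.b * h 1 * (1 - Real.exp (-M.θ * t))|
      ≤ |Real.exp (-M.θ * t) * h 0| + |M.b * h 1 * (1 - Real.exp (-M.θ * t))| := abs_sub _ _
    _ = Real.exp (-M.θ * t) * |h 0| + M.b * |h 1| * (1 - Real.exp (-M.θ * t)) := by
        rw [abs_mul, abs_mul, abs_mul, abs_of_pos he0, abs_of_pos hb,
          abs_of_nonneg (by linarith : 0 ≤ 1 - Real.exp (-M.θ * t))]
    _ ≤ 1 * ‖h‖ + M.b * ‖h‖ * 1 := by gcongr; linarith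
    _ = _ := by ring

/-- The displacement of the controlled pair at time `t` caused by the displacement `h` of the
initial condition. -/
def pairShift (M : Model) (h : Plane) (t : ℝ) : Plane := !₂[stateShift M h t, h 1]

theorem pairShift_smul (M : Model) (c : ℝ) (h : Plane) (t : ℝ) :
    pairShift M (c • h) t = c • pairShift M h t := by
  ext i
  fin_cases i
  · simp [pairShift, stateShift]; ring
  · simp [pairShift]

theorem norm_pairShift_le (M : Model) (h : Plane) {t : ℝ} (ht : 0 ≤ t) :
    ‖pairShift M h t‖ ≤ (2 + M.b) * ‖h‖ := by
  have h1 : |h 1| ≤ ‖h‖ := by simpa using PiLp.norm_apply_le h 1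
  have h0 := abs_stateShift_le M h ht
  have : 0 ≤ (1 + M.b) * ‖h‖ := by have := M.b_pos; positivity
  rw [EuclideanSpace.norm_eq, Fin.sum_univ_two]
  refine Real.sqrt_le_iff.2 ⟨by have := M.b_pos; positivity, ?_⟩
  simp only [pairShift, PiLp.toLp_apply, Matrix.cons_val_zero, Matrix.cons_val_one, Real.norm_eq_abs]
  have e : (2 + M.b) * ‖h‖ = (1 + M.b) * ‖h‖ + ‖h‖ := by ring
  rw [e]
  nlinarith [abs_nonneg (h 1), abs_nonneg (stateShift M h t), norm_nonneg h]

/-- The shift solves `y' = θ(-b h₁ - y)` with `y(0) = h₀`, so adding it absorbs the change of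
initial data while control and noise stay the same. -/
theorem IsStateSolution.shift {z : Plane} {ξ X : ℝ≥0 → Ω → ℝ} (hξ : ξ ∈ admissible P 𝓕)
    (hX : IsStateSolution M P 𝓕 W (z 0) (z 1) ξ X) (h : Plane) :
    IsStateSolution M P 𝓕 W ((z + h) 0) ((z + h) 1) ξ fun t ω => X t ω + stateShift M h t := by
  refine ⟨fun t => (hX.1 t).add_const _, ?_⟩
  filter_upwards [hX.2, hξ.2] with ω hω hξω
  refine ⟨hω.1.add ((continuous_stateShift M h).comp NNReal.continuous_coe), fun t => ?_⟩
  have hR : IntervalIntegrable (fun s : ℝ => M.θ * (M.μ - M.b * controlledLevel (z 1) ξ s.toNNReal ω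
      - X s.toNNReal ω)) volume 0 t := by
    simp_rw [controlledLevel_eq]
    have h1 := intervalIntegrable_toNNReal hξω.2 0 t
    have h2 : IntervalIntegrable (fun s : ℝ => X s.toNNReal ω) volume 0 t :=
      (hω.1.comp continuous_real_toNNReal).intervalIntegrable _ _
    exact ((intervalIntegrable_const.sub ((intervalIntegrable_const.add h1).const_mul _)).sub
      h2).const_mul _
  have hS : IntervalIntegrable (fun s : ℝ => M.θ * (-(M.b * h 1) - stateShift M h s)) volume 0 t :=
    Continuous.intervalIntegrable (by have := continuous_stateShift M h; fun_prop) _ _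
  have hint : ∫ s in (0 : ℝ)..t, M.θ * (-(M.b * h 1) - stateShift M h s) =
      stateShift M h t - stateShift M h 0 :=
    intervalIntegral.integral_eq_sub_of_hasDerivAt (fun s _ => hasDerivAt_stateShift M h s) hS
  have hsum : ∫ s in (0 : ℝ)..t, M.θ * (M.μ - M.b * controlledLevel ((z + h) 1) ξ s.toNNReal ω
      - (X s.toNNReal ω + stateShift M h s.toNNReal)) =
      (∫ s in (0 : ℝ)..t, M.θ * (M.μ - M.b * controlledLevel (z 1) ξ s.toNNReal ω
      - X s.toNNReal ω)) + ∫ s in (0 : ℝ)..t, M.θ * (-(M.b * h 1) - stateShift M h s) := by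
    rw [← intervalIntegral.integral_add hR hS]
    refine intervalIntegral.integral_congr fun s hs => ?_
    rw [uIcc_of_le t.coe_nonneg] at hs
    simp only [controlledLevel_eq, Real.coe_toNNReal _ hs.1, PiLp.add_apply]
    ring
  rw [hsum, hint, hω.2 t]
  simp only [PiLp.add_apply, stateShift, mul_zero, Real.exp_zero]
  ring

theorem admissible_combo {ξ ξ' : ℝ≥0 → Ω → ℝ} (hξ : ξ ∈ admissible P 𝓕)
    (hξ' : ξ' ∈ admissible P 𝓕) {l : ℝ} (hl : l ∈ Icc (0 : ℝ) 1) :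
    (fun t ω => l * ξ t ω + (1 - l) * ξ' t ω) ∈ admissible P 𝓕 := by
  refine ⟨fun t => ((hξ.1 t).const_mul _).add ((hξ'.1 t).const_mul _), ?_⟩
  filter_upwards [hξ.2, hξ'.2] with ω h h'
  refine ⟨fun t => ⟨((h.1 t).1.const_mul _).add ((h'.1 t).1.const_mul _), ?_⟩,
    locallyBoundedVariationOn_combo h.2 h'.2 hl⟩
  obtain ⟨a, ha⟩ := (h.1 t).2
  obtain ⟨a', ha'⟩ := (h'.1 t).2
  exact ⟨l * a + (1 - l) * a', (ha.const_mul _).add (ha'.const_mul _)⟩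

/-- The drift is affine in state and level, and the weights sum to one, so `μ` and the noise
recombine unchanged. -/
theorem IsStateSolution.combo {z z' : Plane} {ξ X ξ' X' : ℝ≥0 → Ω → ℝ} (hξ : ξ ∈ admissible P 𝓕)
    (hX : IsStateSolution M P 𝓕 W (z 0) (z 1) ξ X) (hξ' : ξ' ∈ admissible P 𝓕)
    (hX' : IsStateSolution M P 𝓕 W (z' 0) (z' 1) ξ' X') (l : ℝ) :
    IsStateSolution M P 𝓕 W ((l • z + (1 - l) • z') 0) ((l • z + (1 - l) • z') 1)
      (fun t ω => l * ξ t ω + (1 - l) * ξ' t ω) fun t ω => l * X t ω + (1 - l) * X' t ω := by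
  refine ⟨fun t => ((hX.1 t).const_mul _).add ((hX'.1 t).const_mul _), ?_⟩
  filter_upwards [hX.2, hξ.2, hX'.2, hξ'.2] with ω hω hξω hω' hξω'
  refine ⟨(hω.1.const_mul _).add (hω'.1.const_mul _), fun t => ?_⟩
  have hR : ∀ {ξ X : ℝ≥0 → Ω → ℝ} (r : ℝ), Continuous (fun t => X t ω) →
      LocallyBoundedVariationOn (fun t => ξ t ω) univ →
      IntervalIntegrable (fun s : ℝ => M.θ * (M.μ - M.b * controlledLevel r ξ s.toNNReal ω
      - X s.toNNReal ω)) volume 0 t := by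
    intro ξ X r hX hξ
    simp_rw [controlledLevel_eq]
    have h1 := intervalIntegrable_toNNReal hξ 0 t
    have h2 : IntervalIntegrable (fun s : ℝ => X s.toNNReal ω) volume 0 t :=
      (hX.comp continuous_real_toNNReal).intervalIntegrable _ _
    exact ((intervalIntegrable_const.sub ((intervalIntegrable_const.add h1).const_mul _)).sub
      h2).const_mul _
  have hsum : ∫ s in (0 : ℝ)..t, M.θ * (M.μ - M.b * controlledLevel ((l • z + (1 - l) • z') 1)
      (fun t ω => l * ξ t ω + (1 - l) * ξ' t ω) s.toNNReal ω
      - (l * X s.toNNReal ω + (1 - l) * X' s.toNNReal ω)) =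
      l * (∫ s in (0 : ℝ)..t, M.θ * (M.μ - M.b * controlledLevel (z 1) ξ s.toNNReal ω
      - X s.toNNReal ω)) + (1 - l) * ∫ s in (0 : ℝ)..t,
        M.θ * (M.μ - M.b * controlledLevel (z' 1) ξ' s.toNNReal ω - X' s.toNNReal ω) := by
    rw [← intervalIntegral.integral_const_mul, ← intervalIntegral.integral_const_mul,
      ← intervalIntegral.integral_add ((hR _ hω.1 hξω.2).const_mul _)
        ((hR _ hω'.1 hξω'.2).const_mul _)]
    refine intervalIntegral.integral_congr fun s hs => ?_
    simp only [controlledLevel_eq, PiLp.add_apply, PiLp.smul_apply, smul_eq_mul]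
    ring
  rw [hsum, hω.2 t, hω'.2 t]
  simp only [PiLp.add_apply, PiLp.smul_apply, smul_eq_mul]
  ring

end State

/-! ### The uncontrolled state process and its moments -/

theorem lintegral_exp_neg_mul_rpow_lt_top {ρ : ℝ} (hρ : 0 < ρ) (k : ℝ) :
    ∫⁻ t in Ici (0 : ℝ), ENNReal.ofReal (Real.exp (-ρ * t) * (1 + t) ^ k) < ⊤ := by
  have hcont : ContinuousOn (fun t : ℝ => Real.exp (-ρ * t) * (1 + t) ^ k) (Ici 0) := by
    refine ContinuousOn.mul (by fun_prop) (ContinuousOn.rpow_const (by fun_prop) fun t ht => ?_)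
    left
    have : (0 : ℝ) ≤ t := ht
    positivity
  have hO : (fun t : ℝ => Real.exp (-ρ * t) * (1 + t) ^ k) =O[atTop]
      fun t => Real.exp (-(ρ / 2) * t) := by
    have h1 : (fun t : ℝ => (1 + t) ^ k) =o[atTop] fun t => Real.exp (ρ / 2 * (1 + t)) :=
      (isLittleO_rpow_exp_pos_mul_atTop k (half_pos hρ)).comp_tendsto
        (tendsto_atTop_add_const_left _ 1 tendsto_id)
    have h2 := (Asymptotics.isBigO_refl (fun t : ℝ => Real.exp (-ρ * t)) atTop).mul h1.isBigO
    refine h2.trans (Asymptotics.IsBigO.of_bound (Real.exp (ρ / 2)) (Eventually.of_forall fun t => ?_))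
    rw [← Real.exp_add, Real.norm_of_nonneg (Real.exp_nonneg _),
      Real.norm_of_nonneg (Real.exp_nonneg _), ← Real.exp_add]
    exact le_of_eq (by congr 1; ring)
  have hint := integrable_of_isBigO_exp_neg (half_pos hρ) hcont hO
  rw [setLIntegral_congr Ioi_ae_eq_Ici.symm]
  exact hint.setLIntegral_lt_top

theorem rpow_lintegral_le {α : Type*} [MeasurableSpace α] (ν : Measure α)
    {p : ℝ} (hp : 1 < p) {g : α → ℝ≥0∞} (hg : AEMeasurable g ν) :
    (∫⁻ a, g a ∂ν) ^ p ≤ ν univ ^ (p - 1) * ∫⁻ a, g a ^ p ∂ν := by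
  have h := ENNReal.lintegral_mul_le_Lp_mul_Lq ν (Real.HolderConjugate.conjExponent hp) hg
    (aemeasurable_const (b := (1 : ℝ≥0∞)))
  simp only [Pi.mul_apply, mul_one, ENNReal.one_rpow, lintegral_const, one_mul] at h
  have hp0 : 0 < p := by linarith
  calc (∫⁻ a, g a ∂ν) ^ p
      ≤ ((∫⁻ a, g a ^ p ∂ν) ^ (1 / p) * ν univ ^ (1 / p.conjExponent)) ^ p := by gcongr
    _ = _ := by
      rw [ENNReal.mul_rpow_of_nonneg _ _ hp0.le, ← ENNReal.rpow_mul, ← ENNReal.rpow_mul,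
        one_div_mul_cancel hp0.ne', ENNReal.rpow_one, mul_comm]
      congr 2
      rw [Real.conjExponent]
      field_simp

/-- Scaling: the law of variance `s` is the image of the standard one under multiplication by `√s`,
and `√s ≤ 1 + s`. -/
theorem exists_lintegral_gaussianReal_rpow_le {p : ℝ} (hp : 1 < p) :
    ∃ m : ℝ≥0∞, m ≠ ⊤ ∧ ∀ s : ℝ≥0, ∫⁻ x, ‖x‖ₑ ^ p ∂(gaussianReal 0 s) ≤
      m * ENNReal.ofReal ((1 + s) ^ p) := by
  refine ⟨∫⁻ x, ‖x‖ₑ ^ p ∂(gaussianReal 0 1), ?_, fun s => ?_⟩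
  · have h := memLp_id_gaussianReal' (μ := 0) (v := 1) (ENNReal.ofReal p) ENNReal.ofReal_ne_top
    have h2 := lintegral_rpow_enorm_lt_top_of_eLpNorm_lt_top
      (by simpa using (by linarith : (0 : ℝ) < p)) ENNReal.ofReal_ne_top h.2
    rw [ENNReal.toReal_ofReal (by linarith)] at h2
    exact h2.ne
  · have hs : gaussianReal 0 s = (gaussianReal 0 1).map (√(s : ℝ) * ·) := by
      rw [gaussianReal_map_const_mul]
      congr 1
      · simp
      · ext; simp
    rw [hs, lintegral_map (by fun_prop) (by fun_prop), mul_comm]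
    have : ∀ x : ℝ, ‖√(s : ℝ) * x‖ₑ ^ p = ‖√(s : ℝ)‖ₑ ^ p * ‖x‖ₑ ^ p := fun x => by
      rw [enorm_mul, ENNReal.mul_rpow_of_nonneg _ _ (by linarith)]
    simp_rw [this]
    rw [lintegral_const_mul _ (by fun_prop)]
    gcongr
    rw [← ENNReal.ofReal_rpow_of_nonneg (by positivity) (by linarith),
      Real.enorm_of_nonneg (by positivity)]
    gcongr
    rw [Real.sqrt_le_left (by positivity)]
    nlinarith [s.coe_nonneg]

theorem measurable_setIntegral_left {α : Type*} [MeasurableSpace α] {g : ℝ → α → ℝ} (S : Set ℝ)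
    (hg : Measurable (Function.uncurry g)) : Measurable fun a => ∫ s in S, g s a :=
  hg.stronglyMeasurable.integral_prod_left.measurable

/-! ### The Ornstein–Uhlenbeck process, built path by path -/

section Uncontrolled

variable {Ω : Type*} [mΩ : MeasurableSpace Ω] {P : Measure Ω} {𝓕 : Filtration ℝ≥0 mΩ}
  {W : ℝ≥0 → Ω → ℝ}

/-- The set of bad paths is null, hence in `𝓕 0` by completeness. Cutting the process off there
preserves adaptedness and the marginal laws. -/
theorem exists_continuous_version (h𝓕 : UsualConditions P 𝓕) (hW : IsFiltrationBrownian P 𝓕 W) :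
    ∃ B : ℝ≥0 → Ω → ℝ, (∀ ω, Continuous fun t => B t ω) ∧ (∀ ω, B 0 ω = 0) ∧ Adapted 𝓕 B ∧
      (∀ᵐ ω ∂P, ∀ t, B t ω = W t ω) ∧ ∀ t, HasLaw (B t) (gaussianReal 0 t) P := by
  set S : Set Ω := {ω | Continuous (fun t => W t ω) ∧ W 0 ω = 0}
  have hS : ∀ᵐ ω ∂P, ω ∈ S := hW.brownian.cont.and hW.brownian.eval_zero_ae_eq_zero
  have hSm : MeasurableSet[𝓕 0] S := by
    rw [← compl_compl S]
    exact (h𝓕.complete _ hS).compl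
  have hBW : ∀ᵐ ω ∂P, ∀ t, S.indicator (W t) ω = W t ω := by
    filter_upwards [hS] with ω hω t
    simp [hω]
  refine ⟨fun t => S.indicator (W t), fun ω => ?_, fun ω => ?_, fun t => ?_, hBW, fun t => ?_⟩
  · by_cases h : ω ∈ S
    · simpa [h] using h.1
    · simpa [h] using continuous_const
  · by_cases h : ω ∈ S
    · simpa [h] using h.2
    · simp [h]
  · exact (hW.adapted t).indicator (𝓕.mono zero_le _ hSm)
  · exact (hW.brownian.hasLaw_eval t).congr (hBW.mono fun ω h => h t)

/-- The solution of `dY = θ (μ - Y) dt + η dB`, `Y 0 = 0`, in terms of the path `w` of `B`. -/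
def ouPath (M : Model) (w : ℝ≥0 → ℝ) (t : ℝ) : ℝ :=
  M.μ * (1 - Real.exp (-M.θ * t)) + M.η * (w t.toNNReal -
    M.θ * (Real.exp (-M.θ * t) * ∫ s in (0 : ℝ)..t, Real.exp (M.θ * s) * w s.toNNReal))

theorem continuous_ouPath (M : Model) {w : ℝ≥0 → ℝ} (hw : Continuous w) :
    Continuous (ouPath M w) := by
  have h1 : Continuous fun t : ℝ => ∫ s in (0 : ℝ)..t, Real.exp (M.θ * s) * w s.toNNReal :=
    intervalIntegral.continuous_primitive
      (fun a b => Continuous.intervalIntegrable (by fun_prop) a b) 0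
  unfold ouPath
  fun_prop

theorem ouPath_eq (M : Model) {w : ℝ≥0 → ℝ} (hw : Continuous w) {t : ℝ} :
    ouPath M w t = (∫ s in (0 : ℝ)..t, M.θ * (M.μ - ouPath M w s)) + M.η * w t.toNNReal := by
  have hc := continuous_ouPath M hw
  -- The path `w` need not be differentiable. The function differentiated here is `ouPath M w` minus
  -- the noise term `η w`, which is smooth enough for the fundamental theorem of calculus.
  have hd : ∀ t : ℝ, HasDerivAt (fun t => M.μ * (1 - Real.exp (-M.θ * t)) - M.η * (M.θ *
      (Real.exp (-M.θ * t) * ∫ s in (0 : ℝ)..t, Real.exp (M.θ * s) * w s.toNNReal)))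
      (M.θ * (M.μ - ouPath M w t)) t := by
    intro t
    have h1 : HasDerivAt (fun t => Real.exp (-M.θ * t)) (Real.exp (-M.θ * t) * (-M.θ)) t := by
      simpa using ((hasDerivAt_id t).const_mul (-M.θ)).exp
    have hcont : Continuous fun s : ℝ => Real.exp (M.θ * s) * w s.toNNReal := by fun_prop
    have h2 : HasDerivAt (fun t => ∫ s in (0 : ℝ)..t, Real.exp (M.θ * s) * w s.toNNReal)
        (Real.exp (M.θ * t) * w t.toNNReal) t :=
      intervalIntegral.integral_hasDerivAt_right (hcont.intervalIntegrable _ _)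
        (hcont.stronglyMeasurableAtFilter _ _) hcont.continuousAt
    refine (((h1.const_sub 1).const_mul M.μ).sub
      (((h1.mul h2).const_mul M.θ).const_mul M.η)).congr_deriv ?_
    have he : Real.exp (-M.θ * t) * Real.exp (M.θ * t) = 1 := by
      rw [← Real.exp_add]; simp
    rw [ouPath]
    linear_combination (-M.η * M.θ * w t.toNNReal) * he
  rw [intervalIntegral.integral_eq_sub_of_hasDerivAt (fun s _ => hd s)
    (Continuous.intervalIntegrable (by fun_prop) _ _)]
  simp only [intervalIntegral.integral_same, mul_zero, Real.exp_zero, sub_self, ouPath]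
  ring

theorem enorm_ouPath_le (M : Model) {w : ℝ≥0 → ℝ} (hw : Continuous w) {t : ℝ} (ht : 0 ≤ t) :
    ENNReal.ofReal (1 + |ouPath M w t|) ≤ ENNReal.ofReal (1 + |M.μ| + M.η + M.η * M.θ) *
      (1 + (‖w t.toNNReal‖ₑ + ∫⁻ s in Ioc 0 t, ‖w s.toNNReal‖ₑ)) := by
  have hθ := M.θ_pos
  have hη := M.η_pos
  have hcont : Continuous fun s : ℝ => w s.toNNReal := by fun_prop
  have hJ : ∫⁻ s in Ioc 0 t, ‖w s.toNNReal‖ₑ = ENNReal.ofReal (∫ s in (0 : ℝ)..t, |w s.toNNReal|) := by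
    rw [intervalIntegral.integral_of_le ht, ofReal_integral_eq_lintegral_ofReal]
    · exact lintegral_congr fun s => by rw [← Real.enorm_abs, Real.enorm_of_nonneg (abs_nonneg _)]
    · exact (hcont.abs.intervalIntegrable 0 t).1
    · exact ae_of_all _ fun s => abs_nonneg _
  set J := ∫ s in (0 : ℝ)..t, |w s.toNNReal| with hJdef
  have hJ0 : 0 ≤ J := intervalIntegral.integral_nonneg ht fun s _ => abs_nonneg _
  -- Inside the integral the two exponentials combine to `e^{θ(s - t)} ≤ 1`.
  have hI : |Real.exp (-M.θ * t) * ∫ s in (0 : ℝ)..t, Real.exp (M.θ * s) * w s.toNNReal| ≤ J := by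
    rw [← intervalIntegral.integral_const_mul]
    refine (intervalIntegral.abs_integral_le_integral_abs ht).trans ?_
    refine intervalIntegral.integral_mono_on ht (Continuous.intervalIntegrable (by fun_prop) _ _)
      (Continuous.intervalIntegrable (by fun_prop) _ _) fun s hs => ?_
    rw [← mul_assoc, ← Real.exp_add, abs_mul, abs_of_pos (Real.exp_pos _)]
    refine mul_le_of_le_one_left (abs_nonneg _) (Real.exp_le_one_iff.2 ?_)
    nlinarith [hs.2]
  have he0 : 0 < Real.exp (-M.θ * t) := Real.exp_pos _
  have he1 : Real.exp (-M.θ * t) ≤ 1 := by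
    rw [Real.exp_le_one_iff]; nlinarith [M.θ_pos]
  have hY : |ouPath M w t| ≤ |M.μ| + M.η * (|w t.toNNReal| + M.θ * J) := by
    unfold ouPath
    refine (abs_add_le _ _).trans (add_le_add ?_ ?_)
    · rw [abs_mul, abs_of_nonneg (by linarith : 0 ≤ 1 - Real.exp (-M.θ * t))]
      exact mul_le_of_le_one_right (abs_nonneg _) (by linarith)
    · rw [abs_mul, abs_of_pos hη]
      gcongr
      refine (abs_sub _ _).trans ?_
      gcongr
      rw [abs_mul, abs_of_pos hθ]
      gcongr
  rw [hJ, ← Real.enorm_abs, Real.enorm_of_nonneg (abs_nonneg _), ← ENNReal.ofReal_one,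
    ← ENNReal.ofReal_add (abs_nonneg _) hJ0, ← ENNReal.ofReal_add (by norm_num) (by positivity),
    ← ENNReal.ofReal_mul (by positivity)]
  refine ENNReal.ofReal_le_ofReal ?_
  have h1 := abs_nonneg M.μ
  have h2 := abs_nonneg (w t.toNNReal)
  have h3 := mul_pos hη hθ
  nlinarith [mul_nonneg h1 h2, mul_nonneg h1 hJ0, mul_nonneg hη.le h2, mul_nonneg hη.le hJ0,
    mul_nonneg h3.le h2, mul_nonneg h3.le hJ0]

theorem adapted_ouPath (M : Model) {B : ℝ≥0 → Ω → ℝ} (hc : ∀ ω, Continuous fun t => B t ω)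
    (hB : Adapted 𝓕 B) : Adapted 𝓕 fun t ω => ouPath M (fun s => B s ω) t := by
  intro t
  -- Stopping time at `t` makes the integrand jointly measurable with respect to `𝓕 t` for every
  -- `s`, without changing it on `(0, t]`.
  have hmeas : Measurable[(inferInstance : MeasurableSpace ℝ).prod (𝓕 t)]
      (Function.uncurry fun (s : ℝ) (ω : Ω) => Real.exp (M.θ * s) * B (min s.toNNReal t) ω) := by
    refine measurable_uncurry_of_continuous_of_measurable (m := 𝓕 t) (fun ω => ?_) fun s => ?_
    · have := hc ω
      fun_prop
    · exact Measurable.const_mul (m := 𝓕 t) (hB.measurable_le (min_le_right _ _)) _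
  have hI : Measurable[𝓕 t] fun ω =>
      ∫ s in Ioc (0 : ℝ) t, Real.exp (M.θ * s) * B (min s.toNNReal t) ω := by
    exact @measurable_setIntegral_left Ω (𝓕 t) _ (Ioc (0 : ℝ) t) hmeas
  have hI' : ∀ ω, ∫ s in (0 : ℝ)..t, Real.exp (M.θ * s) * B s.toNNReal ω =
      ∫ s in Ioc (0 : ℝ) t, Real.exp (M.θ * s) * B (min s.toNNReal t) ω := by
    intro ω
    rw [intervalIntegral.integral_of_le t.coe_nonneg]
    refine setIntegral_congr_fun measurableSet_Ioc fun s hs => ?_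
    rw [min_eq_left (Real.toNNReal_le_iff_le_coe.2 hs.2)]
  have hBt : Measurable[𝓕 t] (B t) := hB t
  show Measurable[𝓕 t] fun ω => ouPath M (fun s => B s ω) t
  unfold ouPath
  simp_rw [hI', Real.toNNReal_coe]
  exact ((hBt.sub ((hI.const_mul _).const_mul _)).const_mul _).const_add _

end Uncontrolled

section UncontrolledMoments

variable {Ω : Type*} [mΩ : MeasurableSpace Ω] {P : Measure Ω} {𝓕 : Filtration ℝ≥0 mΩ}
  {W : ℝ≥0 → Ω → ℝ}

theorem one_add_add_rpow_le {p : ℝ} (hp : 1 < p) (a b : ℝ≥0∞) :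
    (1 + (a + b)) ^ p ≤ 2 ^ (p - 1) * 2 ^ (p - 1) * (1 + a ^ p + b ^ p) := by
  have h2 : (1 : ℝ≥0∞) ≤ 2 ^ (p - 1) := ENNReal.one_le_rpow (by norm_num) (by linarith)
  calc (1 + (a + b)) ^ p ≤ 2 ^ (p - 1) * (1 ^ p + (a + b) ^ p) :=
        ENNReal.rpow_add_le_mul_rpow_add_rpow _ _ hp.le
    _ ≤ 2 ^ (p - 1) * (2 ^ (p - 1) * 1 + 2 ^ (p - 1) * (a ^ p + b ^ p)) := by
        gcongr
        · simpa using h2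
        · exact ENNReal.rpow_add_le_mul_rpow_add_rpow _ _ hp.le
    _ = _ := by ring

/-- The integrand is the bound on the state's `p`-th power obtained from Jensen's inequality on `(0,
t]`. Its expectation grows only polynomially in `t`, which the discount factor beats. -/
theorem lintegral_one_add_rpow_add_le {p : ℝ} (hp : 1 < p) [IsProbabilityMeasure P]
    {n : ℝ≥0 → Ω → ℝ≥0∞} (hn : Measurable (Function.uncurry n)) {m : ℝ≥0∞}
    (hm : ∀ s, ∫⁻ ω, n s ω ^ p ∂P ≤ m * ENNReal.ofReal ((1 + s) ^ p)) {t : ℝ} (ht : 0 ≤ t) :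
    ∫⁻ ω, (1 + n t.toNNReal ω ^ p +
        ENNReal.ofReal t ^ (p - 1) * ∫⁻ s in Ioc 0 t, n s.toNNReal ω ^ p) ∂P ≤
      (1 + 2 * m) * ENNReal.ofReal ((1 + t) ^ (2 * p)) := by
  have hnm : ∀ s, Measurable (n s) := fun s => hn.of_uncurry_left
  have hn' : Measurable fun q : ℝ × Ω => n q.1.toNNReal q.2 ^ p :=
    (hn.comp (f := fun q : ℝ × Ω => (q.1.toNNReal, q.2)) (by fun_prop)).pow_const _
  have h1t : 1 ≤ 1 + t := by linarith
  have hmono : ENNReal.ofReal ((1 + t) ^ p) ≤ ENNReal.ofReal ((1 + t) ^ (2 * p)) :=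
    ENNReal.ofReal_le_ofReal (Real.rpow_le_rpow_of_exponent_le h1t (by linarith))
  rw [lintegral_add_left (by fun_prop), lintegral_add_left (by fun_prop), lintegral_const_mul _
    (Measurable.lintegral_prod_right' (f := fun q : Ω × ℝ => n q.2.toNNReal q.1 ^ p)
      (hn'.comp measurable_swap)),
    lintegral_lintegral_swap (f := fun (ω : Ω) (s : ℝ) => n s.toNNReal ω ^ p)
      (hn'.comp measurable_swap).aemeasurable]
  have hJ : ∫⁻ s in Ioc 0 t, ∫⁻ ω, n s.toNNReal ω ^ p ∂P ≤
      ENNReal.ofReal t * (m * ENNReal.ofReal ((1 + t) ^ p)) := by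
    calc _ ≤ ∫⁻ s in Ioc 0 t, m * ENNReal.ofReal ((1 + t) ^ p) := by
          refine setLIntegral_mono measurable_const fun s hs => (hm _).trans ?_
          rw [Real.coe_toNNReal _ hs.1.le]
          have := hs.1
          have := hs.2
          gcongr
      _ = _ := by rw [setLIntegral_const, Real.volume_Ioc, sub_zero, mul_comm]
  have hlast : ENNReal.ofReal t ^ (p - 1) * ENNReal.ofReal t * ENNReal.ofReal ((1 + t) ^ p) ≤
      ENNReal.ofReal ((1 + t) ^ (2 * p)) := by
    rw [ENNReal.ofReal_rpow_of_nonneg ht (by linarith), ← ENNReal.ofReal_mul (by positivity),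
      ← ENNReal.ofReal_mul (by positivity)]
    refine ENNReal.ofReal_le_ofReal ?_
    calc t ^ (p - 1) * t * (1 + t) ^ p ≤ (1 + t) ^ (p - 1) * (1 + t) * (1 + t) ^ p := by
          gcongr
          · linarith
          · linarith
      _ = _ := by
        rw [← Real.rpow_add_one (by positivity), ← Real.rpow_add (by positivity)]
        congr 1
        ring
  calc _ ≤ 1 + m * ENNReal.ofReal ((1 + t) ^ p) + ENNReal.ofReal t ^ (p - 1) *
        (ENNReal.ofReal t * (m * ENNReal.ofReal ((1 + t) ^ p))) := by
        gcongr
        · simp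
        · simpa [Real.coe_toNNReal _ ht] using hm t.toNNReal
    _ = 1 + m * ENNReal.ofReal ((1 + t) ^ p) + m * (ENNReal.ofReal t ^ (p - 1) *
        ENNReal.ofReal t * ENNReal.ofReal ((1 + t) ^ p)) := by ring
    _ ≤ ENNReal.ofReal ((1 + t) ^ (2 * p)) + m * ENNReal.ofReal ((1 + t) ^ (2 * p)) +
        m * ENNReal.ofReal ((1 + t) ^ (2 * p)) := by
        gcongr
        rw [ENNReal.one_le_ofReal]
        exact Real.one_le_rpow h1t (by linarith)
    _ = _ := by ring

theorem lintegral_lintegral_lt_top_of_le [IsProbabilityMeasure P] {ρ k : ℝ} (hρ : 0 < ρ)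
    {h g : ℝ → Ω → ℝ≥0∞} (hh : Measurable (Function.uncurry h)) {D E : ℝ≥0∞} (hEtop : E ≠ ⊤)
    (hE : ∀ t, 0 ≤ t → ∫⁻ ω, h t ω ∂P ≤ E * ENNReal.ofReal ((1 + t) ^ k)) (hDtop : D ≠ ⊤)
    (hg : ∀ ω, ∀ t ∈ Ici (0 : ℝ), g t ω ≤ D * (ENNReal.ofReal (Real.exp (-ρ * t)) * h t ω)) :
    ∫⁻ ω, (∫⁻ t in Ici (0 : ℝ), g t ω) ∂P < ⊤ := by
  have hem : Measurable (Function.uncurry fun (ω : Ω) (t : ℝ) =>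
      ENNReal.ofReal (Real.exp (-ρ * t)) * h t ω) := by
    have h1 : Measurable fun q : Ω × ℝ => ENNReal.ofReal (Real.exp (-ρ * q.2)) := by fun_prop
    exact h1.mul (hh.comp measurable_swap)
  calc _ ≤ ∫⁻ ω, (∫⁻ t in Ici (0 : ℝ), D * (ENNReal.ofReal (Real.exp (-ρ * t)) * h t ω)) ∂P :=
        lintegral_mono fun ω => setLIntegral_mono' measurableSet_Ici (hg ω)
    _ = D * ∫⁻ ω, (∫⁻ t in Ici (0 : ℝ), ENNReal.ofReal (Real.exp (-ρ * t)) * h t ω) ∂P := by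
        rw [← lintegral_const_mul' D _ hDtop]
        exact lintegral_congr fun ω => lintegral_const_mul' D _ hDtop
    _ = D * ∫⁻ t in Ici (0 : ℝ), ∫⁻ ω, ENNReal.ofReal (Real.exp (-ρ * t)) * h t ω ∂P :=
        congrArg (D * ·) (lintegral_lintegral_swap hem.aemeasurable)
    _ ≤ D * ∫⁻ t in Ici (0 : ℝ), E * ENNReal.ofReal (Real.exp (-ρ * t) * (1 + t) ^ k) := by
        refine mul_le_mul_right (setLIntegral_mono' measurableSet_Ici fun t ht => ?_) D
        rw [lintegral_const_mul' _ _ ENNReal.ofReal_ne_top, ENNReal.ofReal_mul (Real.exp_nonneg _),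
          mul_left_comm]
        exact mul_le_mul_right (hE t ht) _
    _ < ⊤ := by
        rw [lintegral_const_mul' _ _ hEtop]
        exact ENNReal.mul_lt_top hDtop.lt_top (ENNReal.mul_lt_top hEtop.lt_top
          (lintegral_exp_neg_mul_rpow_lt_top hρ _))

theorem exists_uncontrolled_solution [IsProbabilityMeasure P] (h𝓕 : UsualConditions P 𝓕)
    (hW : IsFiltrationBrownian P 𝓕 W) (M : Model) {p : ℝ} (hp : 1 < p) :
    ∃ Y : ℝ≥0 → Ω → ℝ, IsStateSolution M P 𝓕 W 0 0 (fun _ _ => 0) Y ∧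
      ∫⁻ ω, (∫⁻ t in Ici (0 : ℝ),
        ENNReal.ofReal (Real.exp (-M.ρ * t) * (1 + |Y t.toNNReal ω|) ^ p)) ∂P < ⊤ := by
  obtain ⟨B, hBc, hB0, hBa, hBW, hBlaw⟩ := exists_continuous_version h𝓕 hW
  obtain ⟨m, hm, hmoment⟩ := exists_lintegral_gaussianReal_rpow_le hp
  refine ⟨fun t ω => ouPath M (fun s => B s ω) t, ⟨adapted_ouPath M hBc hBa, ?_⟩, ?_⟩
  · filter_upwards [hBW] with ω hω
    refine ⟨(continuous_ouPath M (hBc ω)).comp NNReal.continuous_coe, fun t => ?_⟩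
    have hint : ∫ s in (0 : ℝ)..t, M.θ * (M.μ - M.b * controlledLevel 0 (fun _ _ => (0 : ℝ))
        s.toNNReal ω - ouPath M (fun s => B s ω) s.toNNReal) =
        ∫ s in (0 : ℝ)..t, M.θ * (M.μ - ouPath M (fun s => B s ω) s) := by
      refine intervalIntegral.integral_congr fun s hs => ?_
      rw [uIcc_of_le t.coe_nonneg] at hs
      simp only [controlledLevel_eq, Real.coe_toNNReal _ hs.1]
      ring
    rw [hint, ← hω t, ← hω 0, hB0 ω, ouPath_eq M (hBc ω), Real.toNNReal_coe]
    ring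
  set n : ℝ≥0 → Ω → ℝ≥0∞ := fun t ω => ‖B t ω‖ₑ with hn
  have hBm : Measurable (Function.uncurry B) :=
    measurable_uncurry_of_continuous_of_measurable hBc fun t => hBa.measurable
  have hnm : Measurable (Function.uncurry n) := hBm.enorm
  have hnp : ∀ s, ∫⁻ ω, n s ω ^ p ∂P ≤ m * ENNReal.ofReal ((1 + s) ^ p) := fun s =>
    ((hBlaw s).lintegral_comp (f := fun x => ‖x‖ₑ ^ p) (by fun_prop)).trans_le (hmoment s)
  set c := ENNReal.ofReal (1 + |M.μ| + M.η + M.η * M.θ) with hc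
  set D : ℝ≥0∞ := c ^ p * (2 ^ (p - 1) * 2 ^ (p - 1)) with hD
  have hDtop : D ≠ ⊤ := by
    have h2 : (2 : ℝ≥0∞) ^ (p - 1) ≠ ⊤ := ENNReal.rpow_ne_top_of_nonneg (by linarith) (by norm_num)
    exact ENNReal.mul_ne_top (ENNReal.rpow_ne_top_of_nonneg (by linarith) ENNReal.ofReal_ne_top)
      (ENNReal.mul_ne_top h2 h2)
  set h : ℝ → Ω → ℝ≥0∞ := fun t ω => 1 + n t.toNNReal ω ^ p +
        ENNReal.ofReal t ^ (p - 1) * ∫⁻ s in Ioc 0 t, n s.toNNReal ω ^ p with hh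
  have hhm : Measurable (Function.uncurry h) := by
    have h1 : Measurable fun q : ℝ × Ω => n q.1.toNNReal q.2 ^ p :=
      (hnm.comp (f := fun q : ℝ × Ω => (q.1.toNNReal, q.2)) (by fun_prop)).pow_const _
    have h2 : Measurable fun q : ℝ × Ω => ∫⁻ s in Ioc 0 q.1, n s.toNNReal q.2 ^ p := by
      have : ∀ q : ℝ × Ω, ∫⁻ s in Ioc 0 q.1, n s.toNNReal q.2 ^ p =
          ∫⁻ s, {u : (ℝ × Ω) × ℝ | 0 < u.2 ∧ u.2 ≤ u.1.1}.indicator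
            (fun u => n u.2.toNNReal u.1.2 ^ p) (q, s) := fun q => by
        rw [← lintegral_indicator measurableSet_Ioc]
        rfl
      simp_rw [this]
      refine Measurable.lintegral_prod_right' (Measurable.indicator ?_ ?_)
      · exact h1.comp (f := fun u : (ℝ × Ω) × ℝ => (u.2, u.1.2)) (by fun_prop)
      · exact (measurableSet_lt measurable_const measurable_snd).inter
          (measurableSet_le measurable_snd (measurable_fst.comp measurable_fst))
    have h3 : Measurable fun q : ℝ × Ω => ENNReal.ofReal q.1 ^ (p - 1) := by fun_prop
    exact (h1.const_add 1).add (h3.mul h2)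
  have hpt : ∀ ω, ∀ t ∈ Ici (0 : ℝ),
      ENNReal.ofReal (Real.exp (-M.ρ * t) * (1 + |ouPath M (fun s => B s ω) t.toNNReal|) ^ p) ≤
        D * (ENNReal.ofReal (Real.exp (-M.ρ * t)) * h t ω) := by
    intro ω t ht
    have ht0 : (0 : ℝ) ≤ t := ht
    rw [Real.coe_toNNReal _ ht0, ENNReal.ofReal_mul (Real.exp_nonneg _),
      ← ENNReal.ofReal_rpow_of_nonneg (by positivity) (by linarith)]
    have hJ : (∫⁻ s in Ioc 0 t, n s.toNNReal ω) ^ p ≤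
        ENNReal.ofReal t ^ (p - 1) * ∫⁻ s in Ioc 0 t, n s.toNNReal ω ^ p := by
      have := rpow_lintegral_le (volume.restrict (Ioc 0 t)) hp
        (g := fun s => n s.toNNReal ω) (by have := hBc ω; fun_prop)
      simpa using this
    calc _ ≤ ENNReal.ofReal (Real.exp (-M.ρ * t)) *
          (c * (1 + (n t.toNNReal ω + ∫⁻ s in Ioc 0 t, n s.toNNReal ω))) ^ p := by
          gcongr
          exact enorm_ouPath_le M (hBc ω) ht0
      _ ≤ ENNReal.ofReal (Real.exp (-M.ρ * t)) *
          (c ^ p * (2 ^ (p - 1) * 2 ^ (p - 1) * (1 + n t.toNNReal ω ^ p +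
            (∫⁻ s in Ioc 0 t, n s.toNNReal ω) ^ p))) := by
          rw [ENNReal.mul_rpow_of_nonneg _ _ (by linarith)]
          gcongr
          exact one_add_add_rpow_le hp _ _
      _ ≤ ENNReal.ofReal (Real.exp (-M.ρ * t)) *
          (c ^ p * (2 ^ (p - 1) * 2 ^ (p - 1) * h t ω)) := by
          gcongr
          simp only [hh]
          gcongr
      _ = _ := by rw [hD]; ring
  have hE : ∀ t, 0 ≤ t → ∫⁻ ω, h t ω ∂P ≤ (1 + 2 * m) * ENNReal.ofReal ((1 + t) ^ (2 * p)) :=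
    fun t ht => lintegral_one_add_rpow_add_le hp hnm hnp ht
  clear_value h
  exact lintegral_lintegral_lt_top_of_le M.ρ_pos hhm (by finiteness) hE hDtop hpt

end UncontrolledMoments

/-! ### Estimates for the cost and for the value function -/

theorem measurable_of_rightContinuous {g : ℝ≥0 → ℝ} (hg : ∀ t, ContinuousWithinAt g (Ici t) t) :
    Measurable g := by
  have := measurable_uncurry_of_rightContinuous (Ω := Unit) (G := fun t _ => g t)
    (fun t => measurable_const) fun _ => hg
  exact this.comp (f := fun t : ℝ≥0 => (t, ())) (by fun_prop)

/-- On the left, superadditivity of the lower integral suffices; on the right, one summand is an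
explicit measurable function. Hence no measurability of `u₁`, `u₂`, `u` is required. -/
theorem lintegral_discounted_le {ρ l c a : ℝ} (hρ : 0 < ρ) (hl : l ∈ Icc (0 : ℝ) 1) (hc : 0 ≤ c)
    (ha : 0 ≤ a) {u₁ u₂ u : ℝ → ℝ} (h1 : ∀ t, 0 ≤ u₁ t) (h2 : ∀ t, 0 ≤ u₂ t) (hu : ∀ t, 0 ≤ u t)
    (h : ∀ t, 0 ≤ t → l * u₁ t + (1 - l) * u₂ t ≤ (1 + c) * u t + a) :
    ENNReal.ofReal l * (∫⁻ t in Ici (0 : ℝ), ENNReal.ofReal (Real.exp (-ρ * t) * u₁ t)) +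
      ENNReal.ofReal (1 - l) * (∫⁻ t in Ici (0 : ℝ), ENNReal.ofReal (Real.exp (-ρ * t) * u₂ t)) ≤
      ENNReal.ofReal (1 + c) * (∫⁻ t in Ici (0 : ℝ), ENNReal.ofReal (Real.exp (-ρ * t) * u t)) +
        ENNReal.ofReal (a / ρ) := by
  have hl' : 0 ≤ 1 - l := by linarith [hl.2]
  have hconst : ∫⁻ t in Ici (0 : ℝ), ENNReal.ofReal (Real.exp (-ρ * t) * a) =
      ENNReal.ofReal (a / ρ) := by
    have : ∀ t : ℝ, ENNReal.ofReal (Real.exp (-ρ * t) * a) =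
        ENNReal.ofReal (a / ρ) * ENNReal.ofReal (ρ * Real.exp (-ρ * t)) := fun t => by
      rw [← ENNReal.ofReal_mul (by positivity)]
      congr 1
      field_simp
    simp_rw [this]
    rw [lintegral_const_mul' _ _ ENNReal.ofReal_ne_top, lintegral_Ici_exp_neg hρ]
    simp
  rw [← hconst, ← lintegral_const_mul' _ _ ENNReal.ofReal_ne_top,
    ← lintegral_const_mul' _ _ ENNReal.ofReal_ne_top,
    ← lintegral_const_mul' _ _ ENNReal.ofReal_ne_top,
    ← lintegral_add_right (g := fun t => ENNReal.ofReal (Real.exp (-ρ * t) * a)) _ (by fun_prop)]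
  refine (le_lintegral_add _ _).trans (setLIntegral_mono' measurableSet_Ici fun t ht => ?_)
  have he := Real.exp_pos (-ρ * t)
  have := h1 t
  have := h2 t
  have := hu t
  rw [← ENNReal.ofReal_mul hl.1, ← ENNReal.ofReal_mul hl', ← ENNReal.ofReal_mul (by positivity),
    ← ENNReal.ofReal_add (by have := hl.1; positivity) (by positivity),
    ← ENNReal.ofReal_add (by positivity) (by positivity)]
  refine ENNReal.ofReal_le_ofReal ?_
  nlinarith [mul_le_mul_of_nonneg_left (h t ht) he.le]

/-! ### From pathwise inequalities to costs and their infimum -/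

section Cost

variable {Ω : Type*} [mΩ : MeasurableSpace Ω] {P : Measure Ω} {𝓕 : Filtration ℝ≥0 mΩ}
  {W : ℝ≥0 → Ω → ℝ} {M : Model} {f : Plane → ℝ}

/-- The discounted cost of a single scenario. -/
def pathCost (M : Model) (f : Plane → ℝ) (r : ℝ) (ξ X : ℝ≥0 → Ω → ℝ) (ω : Ω) : ℝ≥0∞ :=
  (∫⁻ t in Ici (0 : ℝ), ENNReal.ofReal (Real.exp (-M.ρ * t) *
      f !₂[X t.toNNReal ω, controlledLevel r ξ t.toNNReal ω]))
    + ∫⁻ t in Ici (0 : ℝ), ENNReal.ofReal (Real.exp (-M.ρ * t) * M.K)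
      ∂(totalVarMeasure (fun s => ξ s ω))

theorem cost_eq (r : ℝ) (ξ X : ℝ≥0 → Ω → ℝ) :
    cost M P f r ξ X = ∫⁻ ω, pathCost M f r ξ X ω ∂P := rfl

theorem combo_add_le {l l' k q x y w v : ℝ≥0∞} (hl : l + l' = 1) (hk : 1 ≤ k)
    (h : l * x + l' * y ≤ k * w + q) : l * (x + v) + l' * (y + v) ≤ k * (w + v) + q := by
  calc l * (x + v) + l' * (y + v) = (l * x + l' * y) + (l + l') * v := by ring
    _ ≤ (k * w + q) + k * v := by
        rw [hl]
        gcongr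
    _ = _ := by ring

/-- The three costs share the control, hence the variation term. It is carried along because the
weights sum to one and the right-hand factor is at least one, even if it is infinite. -/
theorem cost_pair_le [IsProbabilityMeasure P] (hf : ∀ z, 0 ≤ f z) {l c a : ℝ}
    (hl : l ∈ Icc (0 : ℝ) 1) (hc : 0 ≤ c) (ha : 0 ≤ a) {r₁ r₂ r : ℝ} {ξ X₁ X₂ X : ℝ≥0 → Ω → ℝ}
    (h : ∀ ω t, l * f !₂[X₁ t ω, controlledLevel r₁ ξ t ω] +
      (1 - l) * f !₂[X₂ t ω, controlledLevel r₂ ξ t ω] ≤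
        (1 + c) * f !₂[X t ω, controlledLevel r ξ t ω] + a) :
    ENNReal.ofReal l * cost M P f r₁ ξ X₁ + ENNReal.ofReal (1 - l) * cost M P f r₂ ξ X₂ ≤
      ENNReal.ofReal (1 + c) * cost M P f r ξ X + ENNReal.ofReal (a / M.ρ) := by
  have hl' : 0 ≤ 1 - l := by linarith [hl.2]
  have hsum : ENNReal.ofReal l + ENNReal.ofReal (1 - l) = 1 := by
    rw [← ENNReal.ofReal_add hl.1 hl']; simp
  have h1c : 1 ≤ ENNReal.ofReal (1 + c) := by rw [ENNReal.one_le_ofReal]; linarith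
  have hconst : ENNReal.ofReal (a / M.ρ) = ∫⁻ _ : Ω, ENNReal.ofReal (a / M.ρ) ∂P := by simp
  simp_rw [cost_eq]
  rw [hconst, ← lintegral_const_mul' _ _ ENNReal.ofReal_ne_top,
    ← lintegral_const_mul' _ _ ENNReal.ofReal_ne_top,
    ← lintegral_const_mul' _ _ ENNReal.ofReal_ne_top,
    ← lintegral_add_right (g := fun _ => ENNReal.ofReal (a / M.ρ)) _ measurable_const]
  refine (le_lintegral_add _ _).trans (lintegral_mono fun ω => ?_)
  have hrun := lintegral_discounted_le M.ρ_pos hl hc ha (fun t => hf _) (fun t => hf _)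
    (fun t => hf _) fun t _ => h ω t.toNNReal
  exact combo_add_le hsum h1c hrun

/-- Needed for convexity, where the expectation of a sum must be bounded by the sum of the
expectations. -/
theorem aemeasurable_pathCost (hf : Continuous f) {x r : ℝ} {ξ X : ℝ≥0 → Ω → ℝ}
    (hξ : ξ ∈ admissible P 𝓕) (hX : IsStateSolution M P 𝓕 W x r ξ X) :
    AEMeasurable (pathCost M f r ξ X) P := by
  obtain ⟨ξ', hξ'm, hξ'e, hξ'c⟩ := exists_measurable_modification (P := P)
    (fun t => hξ.1.measurable (i := t)) (hξ.2.mono fun ω h t => (h.1 t).1)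
  obtain ⟨X', hX'm, hX'e, hX'c⟩ := exists_measurable_modification (P := P)
    (fun t => hX.1.measurable (i := t)) (hX.2.mono fun ω h t => h.1.continuousWithinAt)
  have hρ := M.ρ_pos
  have hξ2 : Measurable fun q : Ω × ℝ => ξ' q.2.toNNReal q.1 :=
    hξ'm.comp (f := fun q : Ω × ℝ => (q.2.toNNReal, q.1)) (by fun_prop)
  have hX2 : Measurable fun q : Ω × ℝ => X' q.2.toNNReal q.1 :=
    hX'm.comp (f := fun q : Ω × ℝ => (q.2.toNNReal, q.1)) (by fun_prop)
  have hpair : Continuous fun q : ℝ × ℝ => f !₂[q.1, r + q.2] := by fun_prop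
  have h1 : Measurable fun ω => ∫⁻ t in Ici (0 : ℝ), ENNReal.ofReal (Real.exp (-M.ρ * t) *
      f !₂[X' t.toNNReal ω, r + ξ' t.toNNReal ω]) := by
    refine Measurable.lintegral_prod_right' (f := fun q : Ω × ℝ =>
      ENNReal.ofReal (Real.exp (-M.ρ * q.2) * f !₂[X' q.2.toNNReal q.1, r + ξ' q.2.toNNReal q.1])) ?_
    have := hpair.measurable.comp (hX2.prodMk hξ2)
    exact Measurable.ennreal_ofReal (Measurable.mul (by fun_prop) this)
  have h2 : Measurable fun ω => ∫⁻ t in Ici (0 : ℝ), ENNReal.ofReal (M.ρ * Real.exp (-M.ρ * t) * M.K) *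
      ENNReal.ofReal (totalVar (fun s => ξ' s ω) t) := by
    refine Measurable.lintegral_prod_right' (f := fun q : Ω × ℝ =>
      ENNReal.ofReal (M.ρ * Real.exp (-M.ρ * q.2) * M.K) *
        ENNReal.ofReal (totalVar (fun s => ξ' s q.1) q.2)) ?_
    exact Measurable.mul (by fun_prop)
      ((measurable_totalVar hξ'm hξ'c).comp measurable_swap).ennreal_ofReal
  refine ⟨_, h1.add h2, ?_⟩
  filter_upwards [hξ.2, hξ'e, hX'e] with ω hω hωξ hωX
  have e1 : (fun s => ξ' s ω) = fun s => ξ s ω := funext hωξ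
  simp only [pathCost, Pi.add_apply]
  rw [lintegral_totalVarMeasure hρ hω.2, e1]
  simp only [controlledLevel_eq, hωξ, hωX]

theorem cost_combo_le (hf : Continuous f) (hf0 : ∀ z, 0 ≤ f z) (hconv : ConvexOn ℝ univ f)
    {z z' : Plane} {ξ X ξ' X' : ℝ≥0 → Ω → ℝ} (hξ : ξ ∈ admissible P 𝓕)
    (hX : IsStateSolution M P 𝓕 W (z 0) (z 1) ξ X) (hξ' : ξ' ∈ admissible P 𝓕)
    (hX' : IsStateSolution M P 𝓕 W (z' 0) (z' 1) ξ' X') {l : ℝ} (hl : l ∈ Icc (0 : ℝ) 1) :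
    cost M P f ((l • z + (1 - l) • z') 1) (fun t ω => l * ξ t ω + (1 - l) * ξ' t ω)
      (fun t ω => l * X t ω + (1 - l) * X' t ω) ≤
      ENNReal.ofReal l * cost M P f (z 1) ξ X + ENNReal.ofReal (1 - l) * cost M P f (z' 1) ξ' X' := by
  have hl' : 0 ≤ 1 - l := by linarith [hl.2]
  have hρ := M.ρ_pos
  have hK := M.K_pos
  simp_rw [cost_eq]
  rw [← lintegral_const_mul' _ _ ENNReal.ofReal_ne_top,
    ← lintegral_const_mul' _ _ ENNReal.ofReal_ne_top,
    ← lintegral_add_left' ((aemeasurable_pathCost hf hξ hX).const_mul _)]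
  refine lintegral_mono_ae ?_
  filter_upwards [hX.2, hξ.2, hX'.2, hξ'.2] with ω hω hξω hω' hξω'
  have hmX : Measurable fun t : ℝ => X t.toNNReal ω := by have := hω.1; fun_prop
  have hmξ : Measurable fun t : ℝ => ξ t.toNNReal ω :=
    (measurable_of_rightContinuous fun t => (hξω.1 t).1).comp measurable_real_toNNReal
  have hpair : Continuous fun q : ℝ × ℝ => f !₂[q.1, z 1 + q.2] := by fun_prop
  have hmf := hpair.measurable.comp (hmX.prodMk hmξ)
  have hrun : (∫⁻ t in Ici (0 : ℝ), ENNReal.ofReal (Real.exp (-M.ρ * t) *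
      f !₂[l * X t.toNNReal ω + (1 - l) * X' t.toNNReal ω,
        (l • z + (1 - l) • z') 1 + (l * ξ t.toNNReal ω + (1 - l) * ξ' t.toNNReal ω)])) ≤
      ENNReal.ofReal l * (∫⁻ t in Ici (0 : ℝ), ENNReal.ofReal (Real.exp (-M.ρ * t) *
        f !₂[X t.toNNReal ω, z 1 + ξ t.toNNReal ω])) +
      ENNReal.ofReal (1 - l) * (∫⁻ t in Ici (0 : ℝ), ENNReal.ofReal (Real.exp (-M.ρ * t) *
        f !₂[X' t.toNNReal ω, z' 1 + ξ' t.toNNReal ω])) := by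
    rw [← lintegral_const_mul' _ _ ENNReal.ofReal_ne_top,
      ← lintegral_const_mul' _ _ ENNReal.ofReal_ne_top, ← lintegral_add_left]
    · refine lintegral_mono fun t => ?_
      have he := Real.exp_pos (-M.ρ * t)
      have hg1 := hf0 !₂[X t.toNNReal ω, z 1 + ξ t.toNNReal ω]
      have hg2 := hf0 !₂[X' t.toNNReal ω, z' 1 + ξ' t.toNNReal ω]
      rw [← ENNReal.ofReal_mul hl.1, ← ENNReal.ofReal_mul hl',
        ← ENNReal.ofReal_add (mul_nonneg hl.1 (by positivity)) (by positivity)]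
      refine ENNReal.ofReal_le_ofReal ?_
      have := hconv.2 (mem_univ !₂[X t.toNNReal ω, z 1 + ξ t.toNNReal ω])
        (mem_univ !₂[X' t.toNNReal ω, z' 1 + ξ' t.toNNReal ω]) hl.1 hl' (by ring)
      have e : l • !₂[X t.toNNReal ω, z 1 + ξ t.toNNReal ω] +
          (1 - l) • !₂[X' t.toNNReal ω, z' 1 + ξ' t.toNNReal ω] =
          !₂[l * X t.toNNReal ω + (1 - l) * X' t.toNNReal ω,
        (l • z + (1 - l) • z') 1 + (l * ξ t.toNNReal ω + (1 - l) * ξ' t.toNNReal ω)] := by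
        ext i
        fin_cases i
        · simp
        · simp; ring
      rw [e, smul_eq_mul, smul_eq_mul] at this
      nlinarith [mul_le_mul_of_nonneg_left this he.le]
    · exact (Measurable.ennreal_ofReal (Measurable.mul (by fun_prop) hmf)).const_mul _
  have hvar : (∫⁻ t in Ici (0 : ℝ), ENNReal.ofReal (Real.exp (-M.ρ * t) * M.K)
      ∂(totalVarMeasure (fun s => l * ξ s ω + (1 - l) * ξ' s ω))) ≤
      ENNReal.ofReal l * (∫⁻ t in Ici (0 : ℝ), ENNReal.ofReal (Real.exp (-M.ρ * t) * M.K)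
        ∂(totalVarMeasure (fun s => ξ s ω))) +
      ENNReal.ofReal (1 - l) * (∫⁻ t in Ici (0 : ℝ), ENNReal.ofReal (Real.exp (-M.ρ * t) * M.K)
        ∂(totalVarMeasure (fun s => ξ' s ω))) := by
    rw [lintegral_totalVarMeasure hρ (locallyBoundedVariationOn_combo hξω.2 hξω'.2 hl),
      lintegral_totalVarMeasure hρ hξω.2, lintegral_totalVarMeasure hρ hξω'.2,
      ← lintegral_const_mul' _ _ ENNReal.ofReal_ne_top,
      ← lintegral_const_mul' _ _ ENNReal.ofReal_ne_top, ← lintegral_add_left]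
    · refine lintegral_mono fun t => ?_
      have hg1 := totalVar_nonneg (fun s => ξ s ω) t
      have hg2 := totalVar_nonneg (fun s => ξ' s ω) t
      rw [mul_left_comm, mul_left_comm (ENNReal.ofReal (1 - l)), ← mul_add]
      gcongr
      rw [← ENNReal.ofReal_mul hl.1, ← ENNReal.ofReal_mul hl',
        ← ENNReal.ofReal_add (mul_nonneg hl.1 hg1) (by positivity)]
      exact ENNReal.ofReal_le_ofReal (totalVar_combo_le hξω.2 hξω'.2 hl t)
    · have h1 : Measurable fun t : ℝ => ENNReal.ofReal (M.ρ * Real.exp (-M.ρ * t) * M.K) := by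
        fun_prop
      exact (h1.mul (monotone_totalVar hξω.2).measurable.ennreal_ofReal).const_mul _
  simp only [pathCost, controlledLevel_eq]
  refine (add_le_add hrun hvar).trans (le_of_eq ?_)
  ring

theorem valueFn_le_cost {z : Plane} {ξ X : ℝ≥0 → Ω → ℝ} (hξ : ξ ∈ admissible P 𝓕)
    (hX : IsStateSolution M P 𝓕 W (z 0) (z 1) ξ X) :
    valueFn M P 𝓕 W f z ≤ cost M P f (z 1) ξ X :=
  (iInf₂_le ξ hξ).trans (iInf₂_le X hX)

/-- Passage to the infimum through an affine map: subtract `B` and divide by `A`, which must be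
neither zero nor infinite. -/
theorem le_mul_valueFn_add {z : Plane} {L A B : ℝ≥0∞} (hA : A ≠ ⊤)
    (h : ∀ ξ ∈ admissible P 𝓕, ∀ X, IsStateSolution M P 𝓕 W (z 0) (z 1) ξ X →
      L ≤ A * cost M P f (z 1) ξ X + B) (hA0 : A ≠ 0) :
    L ≤ A * valueFn M P 𝓕 W f z + B := by
  rw [← tsub_le_iff_right, mul_comm, ← ENNReal.div_le_iff hA0 hA]
  refine le_iInf₂ fun ξ hξ => le_iInf₂ fun X hX => ?_
  rw [ENNReal.div_le_iff hA0 hA, mul_comm, tsub_le_iff_right]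
  exact h ξ hξ X hX

theorem valueFn_combo_le (hf : Continuous f) (hf0 : ∀ z, 0 ≤ f z) (hconv : ConvexOn ℝ univ f)
    (z z' : Plane) {l : ℝ} (hl : l ∈ Ioo (0 : ℝ) 1) :
    valueFn M P 𝓕 W f (l • z + (1 - l) • z') ≤
      ENNReal.ofReal l * valueFn M P 𝓕 W f z + ENNReal.ofReal (1 - l) * valueFn M P 𝓕 W f z' := by
  have h0 : ENNReal.ofReal l ≠ 0 := by simpa using hl.1
  have h1 : ENNReal.ofReal (1 - l) ≠ 0 := by simpa using hl.2
  refine le_mul_valueFn_add (P := P) (𝓕 := 𝓕) ENNReal.ofReal_ne_top (fun ξ hξ X hX => ?_) h0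
  rw [add_comm (ENNReal.ofReal l * _)]
  refine le_mul_valueFn_add (P := P) (𝓕 := 𝓕) ENNReal.ofReal_ne_top (fun ξ' hξ' X' hX' => ?_) h1
  rw [add_comm (ENNReal.ofReal (1 - l) * _)]
  exact (valueFn_le_cost (admissible_combo hξ hξ' (Ioo_subset_Icc_self hl))
    (hX.combo hξ hξ' hX' l)).trans (cost_combo_le hf hf0 hconv hξ hX hξ' hX' (Ioo_subset_Icc_self hl))

/-- A control admissible from `z` is reused from `z₁` and `z₂`, where the trajectories are explicit
displacements of the one from `z`. Only the cost from `z` remains on the right, and the infimum over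
it is taken. -/
theorem valueFn_pair_le [IsProbabilityMeasure P] (hf : ∀ z, 0 ≤ f z) {l c a : ℝ}
    (hl : l ∈ Icc (0 : ℝ) 1) (hc : 0 ≤ c) (ha : 0 ≤ a) {z z₁ z₂ : Plane}
    (h : ∀ w : Plane, ∀ t : ℝ, 0 ≤ t → l * f (w + pairShift M (z₁ - z) t) +
      (1 - l) * f (w + pairShift M (z₂ - z) t) ≤ (1 + c) * f w + a) :
    ENNReal.ofReal l * valueFn M P 𝓕 W f z₁ + ENNReal.ofReal (1 - l) * valueFn M P 𝓕 W f z₂ ≤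
      ENNReal.ofReal (1 + c) * valueFn M P 𝓕 W f z + ENNReal.ofReal (a / M.ρ) := by
  refine le_mul_valueFn_add ENNReal.ofReal_ne_top (fun ξ hξ X hX => ?_) (by simp; linarith)
  have key : ∀ z' : Plane, IsStateSolution M P 𝓕 W (z' 0) (z' 1) ξ
      fun t ω => X t ω + stateShift M (z' - z) t := fun z' => by
    simpa using hX.shift hξ (z' - z)
  have hpair : ∀ (z' : Plane) (t : ℝ≥0) (ω : Ω),
      !₂[X t ω + stateShift M (z' - z) t, controlledLevel (z' 1) ξ t ω] =
        !₂[X t ω, controlledLevel (z 1) ξ t ω] + pairShift M (z' - z) t := fun z' t ω => by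
    ext i
    fin_cases i
    · simp [pairShift]
    · simp [pairShift, controlledLevel_eq]
      ring
  refine le_trans ?_ (cost_pair_le hf hl hc ha (X₁ := fun t ω => X t ω + stateShift M (z₁ - z) t)
    (X₂ := fun t ω => X t ω + stateShift M (z₂ - z) t) (r₁ := z₁ 1) (r₂ := z₂ 1) fun ω t => ?_)
  · gcongr
    · exact valueFn_le_cost hξ (key z₁)
    · exact valueFn_le_cost hξ (key z₂)
  · rw [hpair, hpair]
    exact h _ t t.coe_nonneg

theorem valueFn_le [IsProbabilityMeasure P] (hf : ∀ z, 0 ≤ f z) {c a : ℝ}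
    (hc : 0 ≤ c) (ha : 0 ≤ a) {z z' : Plane}
    (h : ∀ w : Plane, ∀ t : ℝ, 0 ≤ t → f (w + pairShift M (z' - z) t) ≤ (1 + c) * f w + a) :
    valueFn M P 𝓕 W f z' ≤
      ENNReal.ofReal (1 + c) * valueFn M P 𝓕 W f z + ENNReal.ofReal (a / M.ρ) := by
  -- The pair estimate with weight `1` on a single point.
  have := valueFn_pair_le (P := P) (𝓕 := 𝓕) (W := W) (M := M) hf (l := 1) (by simp) hc ha
    (z := z) (z₁ := z') (z₂ := z') fun w t ht => by simpa using h w t ht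
  simpa using this

theorem eVariationOn_zero {α : Type*} [LinearOrder α] (s : Set α) :
    eVariationOn (fun _ : α => (0 : ℝ)) s = 0 :=
  eVariationOn.constant_on ((subsingleton_singleton (a := (0 : ℝ))).anti
    (by rintro _ ⟨_, _, rfl⟩; rfl))

theorem totalVarMeasure_zero : totalVarMeasure (fun _ => 0) = 0 := by
  have hz : ∀ t, totalVar (fun _ => 0) t = 0 := fun t => by
    unfold totalVar
    simp [eVariationOn_zero]
  unfold totalVarMeasure
  split_ifs with hg
  · have : (monotone_totalVar hg).stieltjesFunction = StieltjesFunction.const ℝ 0 := by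
      ext t
      rw [Monotone.stieltjesFunction_eq]
      refine rightLim_eq_of_tendsto ?_
      exact tendsto_const_nhds.congr fun t => (hz t).symm
    rw [this, StieltjesFunction.measure_const]
  · rfl

/-- The zero control has no variation cost, and its running cost is dominated by the discounted
moments of the Ornstein–Uhlenbeck state. -/
theorem valueFn_zero_lt_top [IsProbabilityMeasure P] (h𝓕 : UsualConditions P 𝓕)
    (hW : IsFiltrationBrownian P 𝓕 W) {p C₀ : ℝ} (hp : 1 < p) (hC₀ : 0 < C₀)
    (hgrowth : ∀ z, f z ≤ C₀ * (1 + ‖z‖) ^ p) : valueFn M P 𝓕 W f 0 < ⊤ := by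
  obtain ⟨Y, hY, hfin⟩ := exists_uncontrolled_solution h𝓕 hW M hp
  have hadm : (fun _ _ => 0 : ℝ≥0 → Ω → ℝ) ∈ admissible P 𝓕 := by
    refine ⟨fun t => measurable_const, ae_of_all _ fun ω => ⟨fun t =>
      ⟨continuousWithinAt_const, 0, tendsto_const_nhds⟩, fun a b _ _ => ?_⟩⟩
    simp [BoundedVariationOn, eVariationOn_zero]
  refine (valueFn_le_cost (z := 0) hadm (by simpa using hY)).trans_lt ?_
  rw [cost_eq]
  have hpath : ∀ ω, pathCost M f ((0 : Plane) 1) (fun _ _ => 0) Y ω ≤ ENNReal.ofReal C₀ *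
      ∫⁻ t in Ici (0 : ℝ), ENNReal.ofReal (Real.exp (-M.ρ * t) * (1 + |Y t.toNNReal ω|) ^ p) := by
    intro ω
    rw [pathCost, totalVarMeasure_zero, Measure.restrict_zero, lintegral_zero_measure, add_zero,
      ← lintegral_const_mul' _ _ ENNReal.ofReal_ne_top]
    refine lintegral_mono fun t => ?_
    rw [← ENNReal.ofReal_mul hC₀.le]
    refine ENNReal.ofReal_le_ofReal ?_
    have hn : ‖(!₂[Y t.toNNReal ω, 0] : Plane)‖ = |Y t.toNNReal ω| := by
      rw [EuclideanSpace.norm_eq, Fin.sum_univ_two]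
      simp [Real.sqrt_sq_eq_abs]
    have := hgrowth !₂[Y t.toNNReal ω, 0]
    rw [hn] at this
    simp only [controlledLevel_eq, PiLp.zero_apply, add_zero]
    calc _ ≤ Real.exp (-M.ρ * t) * (C₀ * (1 + |Y t.toNNReal ω|) ^ p) := by gcongr
      _ = _ := by ring
  refine (lintegral_mono hpath).trans_lt ?_
  rw [lintegral_const_mul' _ _ ENNReal.ofReal_ne_top]
  exact ENNReal.mul_lt_top ENNReal.ofReal_lt_top hfin

end Cost

/-! ### Convex and semiconcave functions -/

section Convex

variable {E : Type*} [NormedAddCommGroup E] [NormedSpace ℝ E]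

/-- Hahn–Banach separates `(x, V x)` from the open strict epigraph. The vertical component `c` of
the separating functional is negative, so the functional can be normalised to a supporting slope. -/
theorem exists_subgradient {V : E → ℝ} (hV : ConvexOn ℝ univ V) (hc : Continuous V) (x : E) :
    ∃ L : E →L[ℝ] ℝ, ∀ h, V x + L h ≤ V (x + h) := by
  have hconv : Convex ℝ {q : E × ℝ | q.1 ∈ univ ∧ V q.1 < q.2} := hV.convex_strict_epigraph
  have hopen : IsOpen {q : E × ℝ | q.1 ∈ univ ∧ V q.1 < q.2} := by
    simpa using isOpen_lt (hc.comp continuous_fst) continuous_snd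
  obtain ⟨F, hF⟩ := geometric_hahn_banach_open_point hconv hopen (x := (x, V x)) (by simp)
  set c := F (0, 1) with hcdef
  have hF2 : ∀ (y : E) (s : ℝ), F (y, s) = F (y, 0) + s * c := fun y s => by
    have : ((y, s) : E × ℝ) = (y, 0) + s • (0, 1) := by simp
    rw [this, map_add, map_smul, smul_eq_mul]
  have hc0 : c < 0 := by
    have := hF (x, V x + 1) (by simp)
    rw [hF2 x (V x + 1), hF2 x (V x)] at this
    linarith
  refine ⟨(-c)⁻¹ • F.comp (ContinuousLinearMap.inl ℝ E ℝ), fun h => ?_⟩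
  have hle : F (x + h, 0) + V (x + h) * c ≤ F (x, 0) + V x * c := by
    refine le_of_forall_pos_lt_add fun ε hε => ?_
    have := hF (x + h, V (x + h) + ε / (-c)) (by simp [div_pos hε (neg_pos.2 hc0)])
    rw [hF2 (x + h), hF2 x, add_mul, div_mul_eq_mul_div, mul_div_assoc,
      show c / -c = -1 by rw [div_neg, div_self hc0.ne]] at this
    linarith
  have hsplit : F (x + h, 0) = F (x, 0) + F (h, 0) := by rw [← map_add]; simp
  have : (-c)⁻¹ * F (h, 0) ≤ V (x + h) - V x := by
    rw [inv_mul_le_iff₀ (neg_pos.2 hc0)]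
    linarith
  simpa using (show V x + (-c)⁻¹ * F (h, 0) ≤ V (x + h) by linarith)

/-- The second symmetric differences of `V` are locally bounded by a multiple of `‖h‖ ^ 2`. -/
def SecondDifferenceBound (V : E → ℝ) : Prop :=
  ∀ R : ℝ, ∃ C : ℝ, 0 ≤ C ∧ ∀ x h : E, ‖x‖ ≤ R → ‖h‖ ≤ 1 →
    V (x + h) + V (x - h) - 2 * V x ≤ C * ‖h‖ ^ 2

theorem upper_bound_of_subgradient {V : E → ℝ} {R C : ℝ}
    (hC : ∀ x h : E, ‖x‖ ≤ R → ‖h‖ ≤ 1 → V (x + h) + V (x - h) - 2 * V x ≤ C * ‖h‖ ^ 2)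
    {x : E} (hx : ‖x‖ ≤ R) {L : E →L[ℝ] ℝ} (hL : ∀ h, V x + L h ≤ V (x + h)) {h : E}
    (hh : ‖h‖ ≤ 1) : V (x + h) ≤ V x + L h + C * ‖h‖ ^ 2 := by
  have h1 := hC x h hx hh
  have h2 := hL (-h)
  rw [map_neg, ← sub_eq_add_neg, ← sub_eq_add_neg] at h2
  linarith

/-- The remainder is nonnegative by support and at most `C ‖h‖²` by the second-difference bound. -/
theorem hasFDerivAt_of_subgradient {V : E → ℝ} (hS : SecondDifferenceBound V) {x : E}
    {L : E →L[ℝ] ℝ} (hL : ∀ h, V x + L h ≤ V (x + h)) : HasFDerivAt V L x := by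
  obtain ⟨C, hC0, hC⟩ := hS ‖x‖
  rw [hasFDerivAt_iff_isLittleO_nhds_zero]
  have hO : (fun h => V (x + h) - V x - L h) =O[𝓝 0] fun h : E => ‖h‖ ^ 2 := by
    refine Asymptotics.IsBigO.of_bound C ?_
    filter_upwards [Metric.closedBall_mem_nhds (0 : E) one_pos] with h hh
    have hh' : ‖h‖ ≤ 1 := by simpa using hh
    have h1 := hL h
    have h2 := upper_bound_of_subgradient hC le_rfl hL hh'
    rw [Real.norm_of_nonneg (by linarith), Real.norm_of_nonneg (by positivity)]
    linarith
  exact hO.trans_isLittleO (Asymptotics.isLittleO_norm_pow_id one_lt_two)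

/-- At `y + h` with `‖h‖ = ‖x - y‖`, the affine minorant from `x` lies below the quadratic majorant
from `y`. Together with the majorant from `x` evaluated at `y`, this bounds `(L - L') h` by a
multiple of `‖x - y‖²`; homogeneity does the rest. -/
theorem norm_subgradient_sub_le {V : E → ℝ} {R C : ℝ} (hC0 : 0 ≤ C)
    (hC : ∀ x h : E, ‖x‖ ≤ R → ‖h‖ ≤ 1 → V (x + h) + V (x - h) - 2 * V x ≤ C * ‖h‖ ^ 2)
    {x y : E} (hx : ‖x‖ ≤ R) (hy : ‖y‖ ≤ R) (hxy : ‖x - y‖ ≤ 1) (hne : x ≠ y) {L L' : E →L[ℝ] ℝ}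
    (hL : ∀ h, V x + L h ≤ V (x + h)) (hL' : ∀ h, V y + L' h ≤ V (y + h)) :
    ‖L - L'‖ ≤ 3 * C * ‖x - y‖ := by
  have key : ∀ h : E, ‖h‖ = ‖x - y‖ → (L - L') h ≤ 3 * C * ‖x - y‖ ^ 2 := by
    intro h hh
    have h1 := hL (y + h - x)
    have h2 := upper_bound_of_subgradient hC hy hL' (h := h) (by rw [hh]; exact hxy)
    have h3 := hL' (x - y)
    have h4 := upper_bound_of_subgradient hC hx hL (h := y - x) (by rw [norm_sub_rev]; exact hxy)
    have h5 := upper_bound_of_subgradient hC hy hL' (h := x - y) hxy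
    rw [show x + (y + h - x) = y + h by abel] at h1
    rw [show x + (y - x) = y by abel, norm_sub_rev] at h4
    rw [show y + (x - y) = x by abel] at h3 h5
    rw [hh] at h2
    simp only [map_sub, map_add, sub_apply] at *
    linarith
  have hδ : 0 < ‖x - y‖ := norm_pos_iff.2 (sub_ne_zero.2 hne)
  have hv : ∀ v : E, (L - L') v ≤ 3 * C * ‖x - y‖ * ‖v‖ := by
    intro v
    rcases eq_or_ne v 0 with rfl | hv0
    · simp
    have hv0' : 0 < ‖v‖ := norm_pos_iff.2 hv0
    have h1 := key ((‖x - y‖ / ‖v‖) • v) (by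
      rw [norm_smul, Real.norm_of_nonneg (by positivity)]
      field_simp)
    rw [map_smul, smul_eq_mul, div_mul_eq_mul_div, div_le_iff₀ hv0'] at h1
    refine le_of_mul_le_mul_left ?_ hδ
    calc _ ≤ _ := h1
      _ = _ := by ring
  refine ContinuousLinearMap.opNorm_le_bound _ (by positivity) fun v => ?_
  rw [Real.norm_eq_abs]
  refine abs_le.2 ⟨?_, hv v⟩
  have := hv (-v)
  rw [map_neg, norm_neg] at this
  linarith

theorem contDiff_one_and_locallyLipschitz_fderiv {V : E → ℝ} (hV : ConvexOn ℝ univ V)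
    (hc : Continuous V) (hS : SecondDifferenceBound V) :
    ContDiff ℝ 1 V ∧ LocallyLipschitz (fderiv ℝ V) := by
  choose L hL using exists_subgradient hV hc
  have hd : ∀ x, HasFDerivAt V (L x) x := fun x => hasFDerivAt_of_subgradient hS (hL x)
  have hLV : fderiv ℝ V = L := funext fun x => (hd x).fderiv
  have hlip : LocallyLipschitz (fderiv ℝ V) := by
    intro x₀
    obtain ⟨C, hC0, hC⟩ := hS (‖x₀‖ + 1 / 2)
    -- Radius `1 / 2` keeps any two points of the ball within distance `1`.
    refine ⟨(3 * C).toNNReal, Metric.ball x₀ (1 / 2), Metric.ball_mem_nhds _ (by norm_num), ?_⟩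
    have hR : ∀ x ∈ Metric.ball x₀ (1 / 2), ‖x‖ ≤ ‖x₀‖ + 1 / 2 := fun x hx => by
      have h1 := norm_sub_norm_le x x₀
      rw [mem_ball_iff_norm] at hx
      linarith
    refine LipschitzOnWith.of_dist_le_mul fun x hx y hy => ?_
    rcases eq_or_ne x y with rfl | hne
    · simp
    rw [hLV, dist_eq_norm, dist_eq_norm, Real.coe_toNNReal _ (by positivity)]
    refine norm_subgradient_sub_le hC0 hC (hR x hx) (hR y hy) ?_ hne (hL x) (hL y)
    rw [← dist_eq_norm]
    have := dist_triangle_right x y x₀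
    rw [Metric.mem_ball] at hx hy
    linarith
  exact ⟨contDiff_one_iff_fderiv.2 ⟨fun x => (hd x).differentiableAt, hlip.continuous⟩, hlip⟩

end Convex

/-! ### Weak derivatives -/

theorem memLinftyLoc_of_continuous {u : Plane → ℝ} (hu : Continuous u) : MemLinftyLoc u := by
  intro S hS
  obtain ⟨C, hC⟩ := hS.exists_bound_of_continuousOn hu.continuousOn
  exact memLp_top_of_bound hu.aestronglyMeasurable C
    (ae_restrict_of_forall_mem hS.measurableSet hC)

theorem MemLinftyLoc.locallyIntegrable {u : Plane → ℝ} (hu : MemLinftyLoc u) :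
    LocallyIntegrable u := by
  rw [MeasureTheory.locallyIntegrable_iff]
  intro S hS
  have : IsFiniteMeasure (volume.restrict S) := ⟨by simpa using hS.measure_lt_top⟩
  exact memLp_one_iff_integrable.1 ((hu S hS).mono_exponent le_top)

theorem isWeakPartial_fderiv {u : Plane → ℝ} (hu : ContDiff ℝ 1 u) (i : Fin 2) :
    IsWeakPartial i u fun z => fderiv ℝ u z (EuclideanSpace.single i 1) := by
  have hd : Continuous fun z => fderiv ℝ u z (EuclideanSpace.single i 1) :=
    (hu.continuous_fderiv (by norm_num)).clm_apply continuous_const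
  refine ⟨hu.continuous.locallyIntegrable, hd.locallyIntegrable, fun φ hφ hs => ?_⟩
  have hφ1 : Continuous fun z => fderiv ℝ φ z (EuclideanSpace.single i 1) :=
    (hφ.continuous_fderiv (by simp)).clm_apply continuous_const
  refine integral_mul_fderiv_eq_neg_fderiv_mul_of_integrable ?_ ?_ ?_ ?_ ?_
  · exact (hd.mul hφ.continuous).integrable_of_hasCompactSupport hs.mul_left
  · refine (hu.continuous.mul hφ1).integrable_of_hasCompactSupport ?_
    exact (hs.fderiv_apply (𝕜 := ℝ) _).mul_left
  · exact (hu.continuous.mul hφ.continuous).integrable_of_hasCompactSupport hs.mul_left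
  · exact fun z _ => hu.differentiable (by norm_num) z
  · exact fun z _ => hφ.differentiable (by simp) z

theorem exists_lipschitzWith_eqOn_closedBall {g : Plane → ℝ} (hg : LocallyLipschitz g) (R : ℝ) :
    ∃ (K : ℝ≥0) (G : Plane → ℝ), LipschitzWith K G ∧ EqOn g G (Metric.closedBall 0 R) := by
  obtain ⟨K, hK⟩ := (hg.locallyLipschitzOn (s := Metric.closedBall 0 R)).exists_lipschitzOnWith_of_compact
    (isCompact_closedBall _ _)
  obtain ⟨G, hG, hE⟩ := hK.extend_real
  exact ⟨K, G, hG, hE⟩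

theorem lineDeriv_eq_of_eqOn_closedBall {g G : Plane → ℝ} {R : ℝ}
    (h : EqOn g G (Metric.closedBall 0 R)) {z : Plane} (hz : z ∈ Metric.ball 0 R) (v : Plane) :
    lineDeriv ℝ g z v = lineDeriv ℝ G z v :=
  Filter.EventuallyEq.lineDeriv_eq (mem_of_superset (Metric.isOpen_ball.mem_nhds hz) fun _ hx =>
    h (Metric.ball_subset_closedBall hx))

theorem memLinftyLoc_lineDeriv {g : Plane → ℝ} (hg : LocallyLipschitz g)
    (v : Plane) : MemLinftyLoc fun z => lineDeriv ℝ g z v := by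
  intro S hS
  obtain ⟨R, hR⟩ := hS.isBounded.subset_ball 0
  obtain ⟨K, G, hG, hE⟩ := exists_lipschitzWith_eqOn_closedBall hg R
  refine memLp_top_of_bound (aestronglyMeasurable_lineDeriv hg.continuous _) (K * ‖v‖)
    (ae_restrict_of_forall_mem hS.measurableSet fun z hz => ?_)
  rw [lineDeriv_eq_of_eqOn_closedBall hE (hR hz)]
  exact norm_lineDeriv_le_of_lipschitz ℝ hG

/-- Only the values of `g` near the support of the test function matter. There `g` agrees with a
globally Lipschitz function, for which integration by parts with line derivatives is available. -/
theorem isWeakPartial_lineDeriv {g : Plane → ℝ} (hg : LocallyLipschitz g)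
    (i : Fin 2) : IsWeakPartial i g fun z => lineDeriv ℝ g z (EuclideanSpace.single i 1) := by
  refine ⟨hg.continuous.locallyIntegrable,
    (memLinftyLoc_lineDeriv hg _).locallyIntegrable, fun φ hφ hs => ?_⟩
  obtain ⟨R, hR⟩ := hs.isCompact.isBounded.subset_ball 0
  obtain ⟨K, G, hG, hE⟩ := exists_lipschitzWith_eqOn_closedBall hg R
  obtain ⟨D, hD⟩ := hφ.lipschitzWith_of_hasCompactSupport hs (by simp)
  set v : Plane := EuclideanSpace.single i 1
  have h1 : ∀ z, g z * fderiv ℝ φ z v = -(lineDeriv ℝ φ z (-v) * G z) := by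
    intro z
    rw [(hφ.differentiable (by simp) z).lineDeriv_eq_fderiv, map_neg]
    by_cases hz : z ∈ tsupport φ
    · rw [hE (Metric.ball_subset_closedBall (hR hz))]
      ring
    · rw [image_eq_zero_of_notMem_tsupport fun h => hz (tsupport_fderiv_subset ℝ h)]
      simp
  have h2 : ∀ z, lineDeriv ℝ g z v * φ z = lineDeriv ℝ G z v * φ z := by
    intro z
    by_cases hz : z ∈ tsupport φ
    · rw [lineDeriv_eq_of_eqOn_closedBall hE (hR hz)]
    · rw [image_eq_zero_of_notMem_tsupport hz]
      simp
  simp_rw [h1, h2]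
  rw [integral_neg, hG.integral_lineDeriv_mul_eq hD hs]

theorem memW2InftyLoc_of_memC1LipLoc {u : Plane → ℝ} (hu : MemC1LipLoc u) : MemW2InftyLoc u := by
  have hg : ∀ i : Fin 2, LocallyLipschitz fun z => fderiv ℝ u z (EuclideanSpace.single i 1) :=
    fun i => ((ContinuousLinearMap.apply ℝ ℝ
      (EuclideanSpace.single i 1 : Plane)).lipschitz.locallyLipschitz).comp hu.2
  exact ⟨memLinftyLoc_of_continuous hu.1.continuous,
    fun i z => fderiv ℝ u z (EuclideanSpace.single i 1),
    fun i j z => lineDeriv ℝ (fun z => fderiv ℝ u z (EuclideanSpace.single i 1)) z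
      (EuclideanSpace.single j 1),
    fun i => ⟨isWeakPartial_fderiv hu.1 i, memLinftyLoc_of_continuous (hg i).continuous⟩,
    fun i j => ⟨isWeakPartial_lineDeriv (hg i) j,
      memLinftyLoc_lineDeriv (hg i) _⟩⟩

/-! ### Regularity of the value function -/

theorem toReal_le_of_le_mul_add {u v : ℝ≥0∞} {c b : ℝ} (hc : 0 ≤ c) (hb : 0 ≤ b) (hv : v ≠ ⊤)
    (h : u ≤ ENNReal.ofReal c * v + ENNReal.ofReal b) : u.toReal ≤ c * v.toReal + b := by
  have hcv : ENNReal.ofReal c * v ≠ ⊤ := ENNReal.mul_ne_top ENNReal.ofReal_ne_top hv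
  have := ENNReal.toReal_mono (ENNReal.add_ne_top.2 ⟨hcv, ENNReal.ofReal_ne_top⟩) h
  rwa [ENNReal.toReal_add hcv ENNReal.ofReal_ne_top, ENNReal.toReal_mul, ENNReal.toReal_ofReal hc,
    ENNReal.toReal_ofReal hb] at this

section Value

variable {Ω : Type*} [mΩ : MeasurableSpace Ω] {P : Measure Ω} {𝓕 : Filtration ℝ≥0 mΩ}
  {W : ℝ≥0 → Ω → ℝ} {M : Model} {f : Plane → ℝ} {p C₀ C₁ C₂ : ℝ}

theorem norm_pairShift_rpow_le (M : Model) (hp : 1 < p) (h : Plane) {t : ℝ} (ht : 0 ≤ t) :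
    ‖pairShift M h t‖ ^ p ≤ (2 + M.b) ^ p * ‖h‖ ^ p := by
  have hb := M.b_pos
  rw [← Real.mul_rpow (by positivity) (norm_nonneg _)]
  exact Real.rpow_le_rpow (norm_nonneg _) (norm_pairShift_le M h ht) (by linarith)

/-- Every trajectory is compared with the one from the origin under the same control;
`exists_comparison` then bounds `V z` by `V 0` and `‖z‖ ^ p`. -/
theorem exists_valueFn_growth [IsProbabilityMeasure P] (h𝓕 : UsualConditions P 𝓕)
    (hW : IsFiltrationBrownian P 𝓕 W) (hf : RunningCostAssumption f p C₀ C₁ C₂) (hp : 1 < p)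
    (hC₀ : 0 < C₀) (hC₁ : 0 < C₁) :
    ∃ D : ℝ, 0 < D ∧ ∀ z, valueFn M P 𝓕 W f z ≠ ⊤ ∧
      (valueFn M P 𝓕 W f z).toReal ≤ D * (1 + ‖z‖ ^ p) := by
  obtain ⟨a, ha, hfa⟩ := hf.exists_comparison hp hC₁
  have hρ := M.ρ_pos
  have hb := M.b_pos
  have h0 : valueFn M P 𝓕 W f 0 ≠ ⊤ :=
    (valueFn_zero_lt_top h𝓕 hW hp hC₀ fun z => (hf.growth z).2).ne
  set v := (valueFn M P 𝓕 W f 0).toReal with hv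
  have hv0 : 0 ≤ v := ENNReal.toReal_nonneg
  set κ := (2 + M.b) ^ p with hκ
  have hκ0 : 0 < κ := by positivity
  refine ⟨a * v + a * (1 + κ) / M.ρ, by positivity, fun z => ?_⟩
  have hz : 0 ≤ ‖z‖ ^ p := by positivity
  have hle : valueFn M P 𝓕 W f z ≤ ENNReal.ofReal (1 + (a - 1)) * valueFn M P 𝓕 W f 0 +
      ENNReal.ofReal (a * (1 + κ * ‖z‖ ^ p) / M.ρ) := by
    refine valueFn_le hf.nonneg (by linarith) (by positivity) fun w t ht => ?_
    have h1 := hfa w (w + pairShift M (z - 0) t)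
    have h2 := norm_pairShift_rpow_le M hp (z - 0) ht
    rw [sub_add_cancel_left, norm_neg] at h1
    rw [sub_zero] at *
    have : a * (1 + f w + ‖pairShift M z t‖ ^ p) ≤ a * (1 + f w + κ * ‖z‖ ^ p) := by gcongr
    linarith
  refine ⟨ne_top_of_le_ne_top (by finiteness) hle, ?_⟩
  have := toReal_le_of_le_mul_add (by linarith) (by positivity) h0 hle
  calc _ ≤ a * v + a * (1 + κ * ‖z‖ ^ p) / M.ρ := by rw [← hv] at this; linarith
    _ ≤ a * v * (1 + ‖z‖ ^ p) + a * ((1 + κ) * (1 + ‖z‖ ^ p)) / M.ρ := by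
        refine add_le_add (le_mul_of_one_le_right (by positivity) (by linarith)) ?_
        gcongr
        nlinarith
    _ = _ := by ring

theorem one_add_rpow_le {x y : ℝ} (hp : 1 < p) (hx : 0 ≤ x) (hxy : x ≤ y) :
    1 + x ^ p ≤ 2 * (1 + y) ^ p := by
  have h1 : (1 : ℝ) ≤ (1 + y) ^ p := Real.one_le_rpow (by linarith) (by linarith)
  have h2 : x ^ p ≤ (1 + y) ^ p := Real.rpow_le_rpow hx (by linarith) (by linarith)
  linarith

theorem exists_valueFn_lipschitz [IsProbabilityMeasure P]
    (hf : RunningCostAssumption f p C₀ C₁ C₂) (hp : 1 < p) (hC₁ : 0 < C₁) {D : ℝ} (hD : 0 < D)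
    (hV : ∀ z, valueFn M P 𝓕 W f z ≠ ⊤ ∧ (valueFn M P 𝓕 W f z).toReal ≤ D * (1 + ‖z‖ ^ p)) :
    ∃ D₁ : ℝ, 0 < D₁ ∧ ∀ z z', |(valueFn M P 𝓕 W f z).toReal - (valueFn M P 𝓕 W f z').toReal| ≤
      D₁ * (1 + ‖z‖ + ‖z'‖) ^ (p - 1) * ‖z - z'‖ := by
  have hρ := M.ρ_pos
  have hb := M.b_pos
  obtain ⟨C, hC0, hC⟩ := hf.exists_lipschitz hp hC₁ (κ := 2 + M.b) (by positivity)
  -- The summand `2 D` comes from the growth bound and `1 / ρ` from discounting a constant. The `+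
  -- 1` only ensures positivity, since `C` may vanish.
  refine ⟨C * (2 * D + 1 / M.ρ) + 1, by positivity, ?_⟩
  have main : ∀ z z', (valueFn M P 𝓕 W f z').toReal - (valueFn M P 𝓕 W f z).toReal ≤
      (C * (2 * D + 1 / M.ρ) + 1) * (1 + ‖z‖ + ‖z'‖) ^ (p - 1) * ‖z - z'‖ := by
    intro z z'
    set N := 1 + ‖z‖ + ‖z'‖ with hN
    have hz := norm_nonneg z
    have hz' := norm_nonneg z'
    have hN1 : 1 ≤ N := by linarith
    have hB1 : 1 ≤ N ^ p := Real.one_le_rpow hN1 (by linarith)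
    have hd := norm_sub_le z z'
    have hdB : ‖z - z'‖ ^ p ≤ N ^ p := Real.rpow_le_rpow (norm_nonneg _) (by linarith) (by linarith)
    have hBα : (N ^ p) ^ (1 - 1 / p) = N ^ (p - 1) := by
      rw [← Real.rpow_mul (by linarith)]
      congr 1
      field_simp
    set c := C * (N ^ p) ^ (1 - 1 / p) * ‖z - z'‖ with hc
    have hc0 : 0 ≤ c := by positivity
    have hle : valueFn M P 𝓕 W f z' ≤ ENNReal.ofReal (1 + c / N ^ p) * valueFn M P 𝓕 W f z +
        ENNReal.ofReal (c / M.ρ) := by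
      refine valueFn_le hf.nonneg (by positivity) hc0 fun w t ht => ?_
      refine hC _ _ hB1 (norm_nonneg _) hdB _ _ ?_
      rw [sub_add_cancel_left, norm_neg, norm_sub_rev z z']
      exact norm_pairShift_le M _ ht
    have h1 := toReal_le_of_le_mul_add (by positivity) (by positivity) (hV z).1 hle
    set v := (valueFn M P 𝓕 W f z).toReal
    have h2 : v ≤ 2 * D * N ^ p := by
      calc v ≤ D * (1 + ‖z‖ ^ p) := (hV z).2
        _ ≤ D * (2 * (1 + (‖z‖ + ‖z'‖)) ^ p) := by
            gcongr
            exact one_add_rpow_le hp hz (by linarith)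
        _ = _ := by rw [hN, add_assoc]; ring
    -- The growth bound at scale `N ^ p` turns the multiplicative error into one of order `c`.
    have h3 : c / N ^ p * v ≤ c * (2 * D) := by
      rw [div_mul_eq_mul_div, div_le_iff₀ (by positivity)]
      calc c * v ≤ c * (2 * D * N ^ p) := by gcongr
        _ = _ := by ring
    have h4 : 0 ≤ N ^ (p - 1) * ‖z - z'‖ := by positivity
    calc _ ≤ c * (2 * D) + c / M.ρ := by linarith
      _ = C * (2 * D + 1 / M.ρ) * N ^ (p - 1) * ‖z - z'‖ := by rw [hc, hBα]; ring
      _ ≤ _ := by linarith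
  intro z z'
  refine abs_le.2 ⟨?_, ?_⟩
  · linarith [main z z']
  · have := main z' z
    rw [norm_sub_rev, add_right_comm] at this
    exact this

theorem exists_valueFn_semiconcave [IsProbabilityMeasure P]
    (hf : RunningCostAssumption f p C₀ C₁ C₂) (hp : 1 < p) (hC₁ : 0 < C₁) (hC₂ : 0 < C₂) {D : ℝ}
    (hD : 0 < D)
    (hV : ∀ z, valueFn M P 𝓕 W f z ≠ ⊤ ∧ (valueFn M P 𝓕 W f z).toReal ≤ D * (1 + ‖z‖ ^ p)) :
    ∃ D₂ : ℝ, 0 < D₂ ∧ ∀ z z', ∀ l ∈ Ioo (0 : ℝ) 1,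
      l * (valueFn M P 𝓕 W f z).toReal + (1 - l) * (valueFn M P 𝓕 W f z').toReal -
        (valueFn M P 𝓕 W f (l • z + (1 - l) • z')).toReal ≤
      D₂ * l * (1 - l) * (1 + ‖z‖ + ‖z'‖) ^ (max (p - 2) 0) * ‖z - z'‖ ^ 2 := by
  have hρ := M.ρ_pos
  have hb := M.b_pos
  obtain ⟨C, hC0, hC⟩ := hf.exists_semiconcave hp hC₁ hC₂ (κ := 2 + M.b) (by positivity)
  refine ⟨C * (2 * D + 1 / M.ρ) + 1, by positivity, fun z z' l hl => ?_⟩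
  have hl0 := hl.1
  have hl1 : 0 < 1 - l := by linarith [hl.2]
  set N := 1 + ‖z‖ + ‖z'‖ with hN
  have hz := norm_nonneg z
  have hz' := norm_nonneg z'
  have hN1 : 1 ≤ N := by linarith
  have hB1 : 1 ≤ N ^ p := Real.one_le_rpow hN1 (by linarith)
  have hd := norm_sub_le z z'
  have hdB : ‖z - z'‖ ^ p ≤ N ^ p := Real.rpow_le_rpow (norm_nonneg _) (by linarith) (by linarith)
  have hBβ : (N ^ p) ^ (max (1 - 2 / p) 0) = N ^ (max (p - 2) 0) := by
    rw [← Real.rpow_mul (by linarith), mul_max_of_nonneg _ _ (by linarith)]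
    congr 2
    · field_simp
    · simp
  set m := l • z + (1 - l) • z' with hm
  set c := C * l * (1 - l) * (N ^ p) ^ (max (1 - 2 / p) 0) * ‖z - z'‖ ^ 2 with hc
  have hc0 : 0 ≤ c := by positivity
  have hle : ENNReal.ofReal l * valueFn M P 𝓕 W f z +
      ENNReal.ofReal (1 - l) * valueFn M P 𝓕 W f z' ≤
      ENNReal.ofReal (1 + c / N ^ p) * valueFn M P 𝓕 W f m + ENNReal.ofReal (c / M.ρ) := by
    refine valueFn_pair_le hf.nonneg (Ioo_subset_Icc_self hl) (by positivity) hc0 fun w t ht => ?_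
    -- The two displacements from `m` are opposite multiples of one vector, and so are the displaced
    -- trajectories. Their weighted mean is therefore the trajectory from `m`.
    have e1 : z - m = (1 - l) • (z - z') := by rw [hm]; module
    have e2 : z' - m = (-l) • (z - z') := by rw [hm]; module
    rw [e1, e2, pairShift_smul, pairShift_smul]
    set s := pairShift M (z - z') t with hs
    have e3 : l • (w + (1 - l) • s) + (1 - l) • (w + (-l) • s) = w := by module
    have := hC _ _ l hB1 (norm_nonneg _) hdB hl (w + (1 - l) • s) (w + (-l) • s) (by
      have e4 : w + (1 - l) • s - (w + (-l) • s) = s := by module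
      rw [e4]
      exact norm_pairShift_le M _ ht)
    rwa [e3] at this
  have h1 := toReal_le_of_le_mul_add (by positivity) (by positivity) (hV m).1 hle
  rw [ENNReal.toReal_add (ENNReal.mul_ne_top ENNReal.ofReal_ne_top (hV z).1)
    (ENNReal.mul_ne_top ENNReal.ofReal_ne_top (hV z').1), ENNReal.toReal_mul, ENNReal.toReal_mul,
    ENNReal.toReal_ofReal hl0.le, ENNReal.toReal_ofReal hl1.le] at h1
  set v := (valueFn M P 𝓕 W f m).toReal
  have hmN : ‖m‖ ≤ ‖z‖ + ‖z'‖ := by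
    refine (norm_add_le _ _).trans ?_
    rw [norm_smul, norm_smul, Real.norm_of_nonneg hl0.le, Real.norm_of_nonneg hl1.le]
    exact add_le_add (mul_le_of_le_one_left hz hl.2.le) (mul_le_of_le_one_left hz' (by linarith))
  have h2 : v ≤ 2 * D * N ^ p := by
    calc v ≤ D * (1 + ‖m‖ ^ p) := (hV m).2
      _ ≤ D * (2 * (1 + (‖z‖ + ‖z'‖)) ^ p) := by
          gcongr
          exact one_add_rpow_le hp (norm_nonneg _) hmN
      _ = _ := by rw [hN, add_assoc]; ring
  have h3 : c / N ^ p * v ≤ c * (2 * D) := by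
    rw [div_mul_eq_mul_div, div_le_iff₀ (by positivity)]
    calc c * v ≤ c * (2 * D * N ^ p) := by gcongr
      _ = _ := by ring
  have h4 : 0 ≤ l * (1 - l) * N ^ (max (p - 2) 0) * ‖z - z'‖ ^ 2 := by positivity
  calc _ ≤ c * (2 * D) + c / M.ρ := by linarith
    _ = C * (2 * D + 1 / M.ρ) * (l * (1 - l) * N ^ (max (p - 2) 0) * ‖z - z'‖ ^ 2) := by
        rw [hc, hBβ]; ring
    _ ≤ _ := by linarith

theorem valueFn_toReal_combo_le (hf : RunningCostAssumption f p C₀ C₁ C₂)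
    (hV : ∀ z, valueFn M P 𝓕 W f z ≠ ⊤) (z z' : Plane) {l : ℝ} (hl : l ∈ Ioo (0 : ℝ) 1) :
    (valueFn M P 𝓕 W f (l • z + (1 - l) • z')).toReal ≤
      l * (valueFn M P 𝓕 W f z).toReal + (1 - l) * (valueFn M P 𝓕 W f z').toReal := by
  have h1 := ENNReal.mul_ne_top (ENNReal.ofReal_ne_top (r := l)) (hV z)
  have h2 := ENNReal.mul_ne_top (ENNReal.ofReal_ne_top (r := 1 - l)) (hV z')
  have := ENNReal.toReal_mono (ENNReal.add_ne_top.2 ⟨h1, h2⟩)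
    (valueFn_combo_le (P := P) (𝓕 := 𝓕) (W := W) (M := M) hf.continuous hf.nonneg hf.convexOn z z' hl)
  rwa [ENNReal.toReal_add h1 h2, ENNReal.toReal_mul, ENNReal.toReal_mul,
    ENNReal.toReal_ofReal hl.1.le, ENNReal.toReal_ofReal (by linarith [hl.2])] at this

end Value

theorem locallySemiconcave_of_le {V : Plane → ℝ} {D q : ℝ} (hD : 0 ≤ D) (hq : 0 ≤ q)
    (h : ∀ z z', ∀ l ∈ Ioo (0 : ℝ) 1, l * V z + (1 - l) * V z' - V (l • z + (1 - l) • z') ≤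
      D * l * (1 - l) * (1 + ‖z‖ + ‖z'‖) ^ q * ‖z - z'‖ ^ 2) : LocallySemiconcave V := by
  intro S hS
  obtain ⟨R, hR⟩ := hS.isBounded.exists_norm_le
  refine ⟨D * (1 + |R| + |R|) ^ q, by positivity, fun z z' hzz l hl => ?_⟩
  rcases eq_or_lt_of_le hl.1 with rfl | hl0
  · simp
  rcases eq_or_lt_of_le hl.2 with rfl | hl1
  · simp
  have hz := (hR z (hzz (left_mem_segment ℝ z z'))).trans (le_abs_self R)
  have hz' := (hR z' (hzz (right_mem_segment ℝ z z'))).trans (le_abs_self R)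
  have hl' : 0 ≤ 1 - l := by linarith
  calc _ ≤ D * l * (1 - l) * (1 + ‖z‖ + ‖z'‖) ^ q * ‖z - z'‖ ^ 2 := h z z' l ⟨hl0, hl1⟩
    _ ≤ D * l * (1 - l) * (1 + |R| + |R|) ^ q * ‖z - z'‖ ^ 2 := by gcongr
    _ = _ := by ring

/-- Semiconcavity at the midpoint of `x + y` and `x - y`, whose norms are at most `|R| + 1`. -/
theorem secondDifferenceBound_of_le {V : Plane → ℝ} {D q : ℝ} (hD : 0 ≤ D) (hq : 0 ≤ q)
    (h : ∀ z z', ∀ l ∈ Ioo (0 : ℝ) 1, l * V z + (1 - l) * V z' - V (l • z + (1 - l) • z') ≤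
      D * l * (1 - l) * (1 + ‖z‖ + ‖z'‖) ^ q * ‖z - z'‖ ^ 2) : SecondDifferenceBound V := by
  intro R
  refine ⟨2 * D * (1 + (|R| + 1) + (|R| + 1)) ^ q, by positivity, fun x y hx hy => ?_⟩
  have h1 := h (x + y) (x - y) (1 / 2) (by norm_num)
  have e1 : (1 / 2 : ℝ) • (x + y) + (1 - 1 / 2 : ℝ) • (x - y) = x := by module
  have e2 : x + y - (x - y) = (2 : ℝ) • y := by module
  rw [e1, e2, norm_smul, Real.norm_of_nonneg (by norm_num : (0 : ℝ) ≤ 2)] at h1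
  have hxR := hx.trans (le_abs_self R)
  have h2 : ‖x + y‖ ≤ |R| + 1 := (norm_add_le _ _).trans (add_le_add hxR hy)
  have h3 : ‖x - y‖ ≤ |R| + 1 := (norm_sub_le _ _).trans (add_le_add hxR hy)
  have h4 : D * (1 / 2) * (1 - 1 / 2) * (1 + ‖x + y‖ + ‖x - y‖) ^ q * (2 * ‖y‖) ^ 2 ≤
      D * (1 / 2) * (1 - 1 / 2) * (1 + (|R| + 1) + (|R| + 1)) ^ q * (2 * ‖y‖) ^ 2 := by
    gcongr
  linarith

end

end MeanRevControl

/-! ### The main theorem -/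

theorem mainTheorem6 {Ω : Type*} [mΩ : MeasurableSpace Ω] (P : Measure Ω) [IsProbabilityMeasure P]
    (𝓕 : Filtration ℝ≥0 mΩ) (h𝓕 : MeanRevControl.UsualConditions P 𝓕)
    (W : ℝ≥0 → Ω → ℝ) (hW : MeanRevControl.IsFiltrationBrownian P 𝓕 W)
    (M : MeanRevControl.Model) (f : MeanRevControl.Plane → ℝ)
    (p C₀ C₁ C₂ : ℝ) (hp : 1 < p) (hC₀ : 0 < C₀) (hC₁ : 0 < C₁) (hC₂ : 0 < C₂)
    (hf : MeanRevControl.RunningCostAssumption f p C₀ C₁ C₂)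
    (V : MeanRevControl.Plane → ℝ)
    (hV : V = fun z => (MeanRevControl.valueFn M P 𝓕 W f z).toReal) :
    (∀ z, MeanRevControl.valueFn M P 𝓕 W f z ≠ ⊤) ∧
    (∃ D₀ D₁ D₂ : ℝ, 0 < D₀ ∧ 0 < D₁ ∧ 0 < D₂ ∧
      (∀ z, 0 ≤ V z ∧
        V z ≤ D₀ * (1 + ‖z‖ ^ p) + min (-M.K * min (z 1) 0) (M.K * max (z 1) 0)) ∧
      (∀ z z', |V z - V z'| ≤ D₁ * (1 + ‖z‖ + ‖z'‖) ^ (p - 1) * ‖z - z'‖) ∧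
      (∀ z z', ∀ l ∈ Ioo (0 : ℝ) 1,
        0 ≤ l * V z + (1 - l) * V z' - V (l • z + (1 - l) • z') ∧
        l * V z + (1 - l) * V z' - V (l • z + (1 - l) • z') ≤
          D₂ * l * (1 - l) * (1 + ‖z‖ + ‖z'‖) ^ (max (p - 2) 0) * ‖z - z'‖ ^ 2)) ∧
    ConvexOn ℝ univ V ∧ MeanRevControl.LocallySemiconcave V ∧
    MeanRevControl.MemW2InftyLoc V ∧ MeanRevControl.MemC1LipLoc V := by
  obtain ⟨D₀, hD₀, hgrowth⟩ := MeanRevControl.exists_valueFn_growth (M := M) h𝓕 hW hf hp hC₀ hC₁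
  obtain ⟨D₁, hD₁, hlip⟩ := MeanRevControl.exists_valueFn_lipschitz hf hp hC₁ hD₀ hgrowth
  obtain ⟨D₂, hD₂, hsemi⟩ := MeanRevControl.exists_valueFn_semiconcave hf hp hC₁ hC₂ hD₀ hgrowth
  have hfin : ∀ z, MeanRevControl.valueFn M P 𝓕 W f z ≠ ⊤ := fun z => (hgrowth z).1
  have hconv : ∀ z z', ∀ l ∈ Ioo (0 : ℝ) 1, V (l • z + (1 - l) • z') ≤ l * V z + (1 - l) * V z' := by
    rw [hV]
    exact fun z z' l hl => MeanRevControl.valueFn_toReal_combo_le hf hfin z z' hl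
  have hsemiV : ∀ z z', ∀ l ∈ Ioo (0 : ℝ) 1,
      l * V z + (1 - l) * V z' - V (l • z + (1 - l) • z') ≤
        D₂ * l * (1 - l) * (1 + ‖z‖ + ‖z'‖) ^ (max (p - 2) 0) * ‖z - z'‖ ^ 2 := by
    rw [hV]
    exact hsemi
  have hconvOn : ConvexOn ℝ univ V := by
    refine convexOn_iff_forall_pos.2 ⟨convex_univ, fun z _ z' _ a b ha hb hab => ?_⟩
    obtain rfl : b = 1 - a := by linarith
    exact hconv z z' a ⟨ha, by linarith⟩
  have hC1 : MeanRevControl.MemC1LipLoc V :=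
    MeanRevControl.contDiff_one_and_locallyLipschitz_fderiv hconvOn
      (continuousOn_univ.1 (hconvOn.continuousOn isOpen_univ))
      (MeanRevControl.secondDifferenceBound_of_le hD₂.le (le_max_right _ _) hsemiV)
  refine ⟨hfin, ⟨D₀, D₁, D₂, hD₀, hD₁, hD₂, fun z => ⟨?_, ?_⟩, ?_, fun z z' l hl =>
    ⟨sub_nonneg.2 (hconv z z' l hl), hsemiV z z' l hl⟩⟩, hconvOn,
    MeanRevControl.locallySemiconcave_of_le hD₂.le (le_max_right _ _) hsemiV,
    MeanRevControl.memW2InftyLoc_of_memC1LipLoc hC1, hC1⟩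
  · rw [hV]
    exact ENNReal.toReal_nonneg
  -- The extra term is nonnegative, so the pure growth bound is already stronger.
  · have hmin : 0 ≤ min (-M.K * min (z 1) 0) (M.K * max (z 1) 0) := by
      have hK := M.K_pos
      refine le_min ?_ (mul_nonneg hK.le (le_max_right _ _))
      nlinarith [min_le_right (z 1) 0]
    have := (hgrowth z).2
    rw [hV]
    linarith
  · rw [hV]
    exact hlip
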